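/- Let $N\ge 2$ and let $\Omega\subseteq\mathbb R^N$ be open. Let $A:(0,\infty)\to(0,\infty)$ be of class $C^1$ with $$\limsup_{t\to0^+}tA(t)<\infty,\qquad -1<\inf_{t>0}\frac{tA'(t)}{A(t)}\le\sup_{t>0}\frac{tA'(t)}{A(t)}<\infty,$$ and $A(t)\ge K t^{\vartheta}$ for all $t>0$, for some $K>0$ and $\vartheta\ge0$. Let $B:[0,\infty)\to[0,\infty)$ be of class $C^1$ with $B(0)=0$ and, for some $\hat C>0$, $B'(t)\le\hat C\,tA(t)$ for all $t>0$. Let $f:\mathbb R\to\mathbb R$ be locally Lipschitz with $f(s)>0$ for $s>0$. Let $u\in C^{1,\alpha}(\Omega)$ (for some $\alpha\in(0,1]$, the Hölder condition on $\nabla u$ being local in $\Omega$) be a positive weak solution of $-\operatorname{div}(A(|\nabla u|)\nabla u)+B(|\nabla u|)=f(u)$ in $\Omega$, that is, $u>0$ in $\Omega$ and $$\int_\Omega A(|\nabla u|)\,\nabla u\cdot\nabla\psi\,dx+\int_\Omega B(|\nabla u|)\,\psi\,dx=\int_\Omega f(u)\,\psi\,dx\qquad\text{for all }\psi\in C_c^\infty(\Omega),$$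 where $A(|\nabla u|)\nabla u$ is read as $0$ where $\nabla u=0$. Put $\rho=A(|\nabla u|)$. For open $\Omega'\subseteq\Omega$ let $W^{1,2}_{0,\rho}(\Omega')$ be the completion of $\{\varphi\in C_c^\infty(\Omega'):\int_{\Omega'}\rho|\nabla\varphi|^2dx<\infty\}$ under the norm $\big(\int_{\Omega'}\rho|\nabla\varphi|^2dx\big)^{1/2}$. Let $D$ be either a compact subset of $\Omega$, or $D=\Omega$ provided that $\Omega$ is bounded, $u$ and $\nabla u$ extend continuously to $\overline\Omega$, and the extension of $\nabla u$ has no zero on $\partial\Omega$. Then for every open $\Omega'\subseteq D$ the elements $w$ of $W^{1,2}_{0,\rho}(\Omega')$ are functions in $L^2(\Omega')$ (a sequence of test functions that is Cauchy in the norm above converges in $L^2(\Omega')$, and its gradients converge in $L^2(\Omega',\rho)$ to $\nabla w$), and there is a finite constant $C_P(\Omega')$ with $$\int_{\Omega'}w^2\,dx\le C_P(\Omega')\int_{\Omega'}A(|\nabla u|)\,|\nabla w|^2\,dx\qquad\text{for all }w\in W^{1,2}_{0,\rho}(\Omega').$$ Moreover, for fixed $u$ and $D$, the constants $C_P(\Omega')$,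 $\Omega'\subseteq D$ open, can be chosen so that $C_P(\Omega')\to0$ as $|\Omega'|\to0$. -/

import Mathlib

open Set Filter Topology MeasureTheory
open scoped NNReal ENNReal ContDiff

/-- Structural conditions on the coefficient `A : (0,∞) → (0,∞)` (the value `A 0` plays no role):
`A` is positive and of class `C¹`, `limsup_{t → 0⁺} t A(t) < ∞`,
`-1 < inf t A'(t) / A(t)`, `sup t A'(t) / A(t) < ∞`, and `A(t) ≥ K t ^ θ` for some
`θ ≥ 0`, `K > 0`. -/
structure IsCoeffA (A : ℝ → ℝ) : Prop where
  pos : ∀ t, 0 < t → 0 < A t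
  contDiffOn : ContDiffOn ℝ 1 A (Ioi 0)
  limsup_lt : IsBoundedUnder (· ≤ ·) (𝓝[>] (0 : ℝ)) (fun t => t * A t)
  lower : ∃ m : ℝ, -1 < m ∧ ∀ t, 0 < t → m ≤ t * deriv A t / A t
  upper : ∃ M : ℝ, ∀ t, 0 < t → t * deriv A t / A t ≤ M
  growth : ∃ θ : ℝ, 0 ≤ θ ∧ ∃ K : ℝ, 0 < K ∧ ∀ t, 0 < t → K * t ^ θ ≤ A t

/-- Structural conditions on the first order term `B : [0,∞) → [0,∞)`: it is of class `C¹`,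
`B(0) = 0` and `B'(t) ≤ Ĉ t A(t)` for some `Ĉ > 0` and all `t > 0`. -/
structure IsCoeffB (A B : ℝ → ℝ) : Prop where
  nonneg : ∀ t, 0 ≤ t → 0 ≤ B t
  contDiffOn : ContDiffOn ℝ 1 B (Ici 0)
  zero : B 0 = 0
  deriv_le : ∃ C : ℝ, 0 < C ∧ ∀ t, 0 < t → deriv B t ≤ C * (t * A t)

/-- `φ ∈ C_c^∞(U)`. -/
structure IsTestFun {N : ℕ} (U : Set (EuclideanSpace ℝ (Fin N)))
    (φ : EuclideanSpace ℝ (Fin N) → ℝ) : Prop where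
  smooth : ContDiff ℝ ((⊤ : ℕ∞) : WithTop ℕ∞) φ
  compact : HasCompactSupport φ
  subset : tsupport φ ⊆ U

/-- `u ∈ C^{1,α}(Ω)` for some exponent `α ∈ (0,1]`, the Hölder condition on the gradient being
local in `Ω`. -/
def IsC1Holder {N : ℕ} (Ω : Set (EuclideanSpace ℝ (Fin N)))
    (u : EuclideanSpace ℝ (Fin N) → ℝ) : Prop :=
  ContDiffOn ℝ 1 u Ω ∧
    ∃ α : ℝ≥0, 0 < α ∧ α ≤ 1 ∧
      ∀ K : Set (EuclideanSpace ℝ (Fin N)), IsCompact K → K ⊆ Ω →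
        ∃ C : ℝ≥0, HolderOnWith C α (gradient u) K

/-- `u` is a weak solution, of class `C^{1,α}(Ω)`, of
`-div (A(|∇u|) ∇u) + B(|∇u|) = f(u)` in `Ω`. At critical points of `u` the field
`A(|∇u|) ∇u` is zero, whatever the value `A 0`. -/
structure IsWeakSolution {N : ℕ} (A B f : ℝ → ℝ) (Ω : Set (EuclideanSpace ℝ (Fin N)))
    (u : EuclideanSpace ℝ (Fin N) → ℝ) : Prop where
  regular : IsC1Holder Ω u
  weak : ∀ ψ : EuclideanSpace ℝ (Fin N) → ℝ, IsTestFun Ω ψ →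
    (∫ x in Ω, A ‖gradient u x‖ * inner ℝ (gradient u x) (gradient ψ x)) +
      ∫ x in Ω, B ‖gradient u x‖ * ψ x = ∫ x in Ω, f (u x) * ψ x

/-- The weighted energy `∫_U ρ |g|² dx ∈ [0,∞]` of a vector field `g`. -/
noncomputable def energy {N : ℕ} (ρ : EuclideanSpace ℝ (Fin N) → ℝ)
    (U : Set (EuclideanSpace ℝ (Fin N)))
    (g : EuclideanSpace ℝ (Fin N) → EuclideanSpace ℝ (Fin N)) : ℝ≥0∞ :=
  ∫⁻ x in U, ENNReal.ofReal (ρ x) * ‖g x‖ₑ ^ 2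

/-- The test functions on `U` whose norm `‖∇φ‖_{L²(U,ρ)}` is finite (all of `C_c^∞(U)` if `ρ` is
locally integrable in `U`). -/
def IsFiniteTestFun {N : ℕ} (ρ : EuclideanSpace ℝ (Fin N) → ℝ)
    (U : Set (EuclideanSpace ℝ (Fin N))) (φ : EuclideanSpace ℝ (Fin N) → ℝ) : Prop :=
  IsTestFun U φ ∧ energy ρ U (gradient φ) ≠ ⊤

/-- `(φ n)` is a Cauchy sequence of test functions for the norm `‖∇φ‖_{L²(U,ρ)}`; the
completion `W^{1,2}_{0,ρ}(U)` is the set of classes of such sequences. -/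
def IsEnergyCauchy {N : ℕ} (ρ : EuclideanSpace ℝ (Fin N) → ℝ)
    (U : Set (EuclideanSpace ℝ (Fin N))) (φ : ℕ → EuclideanSpace ℝ (Fin N) → ℝ) : Prop :=
  (∀ n, IsFiniteTestFun ρ U (φ n)) ∧
    Tendsto (fun p : ℕ × ℕ => energy ρ U (fun x => gradient (φ p.1) x - gradient (φ p.2) x))
      atTop (𝓝 0)

/-- `w`, with gradient `g`, is an element of `W^{1,2}_{0,ρ}(U)`: for some sequence of test
functions `φ n` of finite norm one has `∇ φ n → g` in `L²(U,ρ)` and `φ n → w` in measure on `U`.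
(Convergence in measure only serves to say which function `w` the element is.) -/
def MemW0 {N : ℕ} (ρ : EuclideanSpace ℝ (Fin N) → ℝ) (U : Set (EuclideanSpace ℝ (Fin N)))
    (w : EuclideanSpace ℝ (Fin N) → ℝ)
    (g : EuclideanSpace ℝ (Fin N) → EuclideanSpace ℝ (Fin N)) : Prop :=
  AEStronglyMeasurable w (volume.restrict U) ∧ AEStronglyMeasurable g (volume.restrict U) ∧
    ∃ φ : ℕ → EuclideanSpace ℝ (Fin N) → ℝ,
      (∀ n, IsFiniteTestFun ρ U (φ n)) ∧
      Tendsto (fun n => energy ρ U (fun x => gradient (φ n) x - g x)) atTop (𝓝 0) ∧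
      TendstoInMeasure (volume.restrict U) φ atTop w

/-- The weighted Poincaré inequality with weight `ρ` on the open subsets `U` of `D`: there are
finite constants `C_P(U)`, with `C_P(U) → 0` as `|U| → 0`, such that
`∫_U w² ≤ C_P(U) ∫_U ρ |∇w|²` for all `w ∈ W^{1,2}_{0,ρ}(U)`. The first clause says
that each element of the completion is a function in `L²(U)`, so that the second clause
applies to it. -/
def WeightedPoincare {N : ℕ} (ρ : EuclideanSpace ℝ (Fin N) → ℝ)
    (D : Set (EuclideanSpace ℝ (Fin N))) : Prop :=
  ∃ CP : Set (EuclideanSpace ℝ (Fin N)) → ℝ≥0,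
    (∀ U : Set (EuclideanSpace ℝ (Fin N)), IsOpen U → U ⊆ D →
      (∀ φ : ℕ → EuclideanSpace ℝ (Fin N) → ℝ, IsEnergyCauchy ρ U φ →
        ∃ (w : EuclideanSpace ℝ (Fin N) → ℝ)
          (g : EuclideanSpace ℝ (Fin N) → EuclideanSpace ℝ (Fin N)),
          MemW0 ρ U w g ∧
          Tendsto (fun n => ∫⁻ x in U, ‖φ n x - w x‖ₑ ^ 2) atTop (𝓝 0) ∧
          Tendsto (fun n => energy ρ U (fun x => gradient (φ n) x - g x)) atTop (𝓝 0)) ∧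
      (∀ (w : EuclideanSpace ℝ (Fin N) → ℝ)
          (g : EuclideanSpace ℝ (Fin N) → EuclideanSpace ℝ (Fin N)), MemW0 ρ U w g →
        ∫⁻ x in U, ‖w x‖ₑ ^ 2 ≤ (CP U : ℝ≥0∞) * energy ρ U g)) ∧
    (∀ ε : ℝ≥0, 0 < ε → ∃ δ : ℝ≥0, 0 < δ ∧
      ∀ U : Set (EuclideanSpace ℝ (Fin N)), IsOpen U → U ⊆ D → volume U ≤ δ → CP U ≤ ε)

/-- `u` is of class `C¹` up to the boundary of `Ω` (`u` and `∇u` extend continuously to the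
closure) and has no critical point on the boundary. -/
def NoBoundaryCritical {N : ℕ} (Ω : Set (EuclideanSpace ℝ (Fin N)))
    (u : EuclideanSpace ℝ (Fin N) → ℝ) : Prop :=
  ∃ (v : EuclideanSpace ℝ (Fin N) → ℝ)
    (G : EuclideanSpace ℝ (Fin N) → EuclideanSpace ℝ (Fin N)),
    ContinuousOn v (closure Ω) ∧ EqOn v u Ω ∧
    ContinuousOn G (closure Ω) ∧ EqOn G (gradient u) Ω ∧
    ∀ x ∈ frontier Ω, G x ≠ 0

/-! Write `ρ = A(|∇u|)`, `q = ρ|∇u|²`, and for a test function `φ` on `U` let `W = ∫ φ²`, `E = ∫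
ρ|∇φ|²`, `Y = ∫ q φ²`. Testing the equation with `φ² exp(-l u)` gives `∫ (f(u) - B(|∇u|) + l q)
exp(-l u) φ² = ∫ 2 φ exp(-l u) ρ ∇u·∇φ`. At critical points `q` and `B(|∇u|)` vanish and `f(u) > 0`,
while `q > 0` elsewhere; by compactness the bracket is at least some `c > 0` once `l` is large.
Young's inequality on the right then gives `W ≤ C (s Y + E / s)` for every `s > 0`
(`IsWeakSolution.exists_integral_sq_le`).

As `q` is bounded, a small `s` lets `Y` be absorbed, and `W ≤ C₀ E`. For the decay of the constant,
`s` is taken large instead, so that `E / s` is small. The part of `Y` where `q < m` is at most `m W`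
and is absorbed for small `m`. Where `q ≥ m` the gradient is nonzero and `ρ` is bounded below, so a
cutoff and the unweighted `W^{1,1}` Sobolev inequality bound that part by a multiple of `|U|^{1/N}
(W + E)` (`exists_integral_sq_cutoff_le`).

The inequality passes from test functions to the completion by completeness of `L²` and Fatou's
lemma (`weightedPoincare_of_isFiniteTestFun`). -/

/-! ### From smooth to `C¹` test functions. -/

/-- Dominated convergence with majorant `‖F‖ (C + 1)`, where `C` bounds the limit `G₀` on `K`. It
serves both for gradients and, with `V = ℝ`, for the zero order terms. -/
theorem tendsto_setIntegral_inner_of_dist_le {E V : Type*}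
    [NormedAddCommGroup E] [MeasurableSpace E] [BorelSpace E] {μ : Measure E} [NormedAddCommGroup V]
    [InnerProductSpace ℝ V] {Ω K : Set E} (hΩ : MeasurableSet Ω)
    (hK : IsCompact K) (hKΩ : K ⊆ Ω)
    {F : E → V} (hF : IntegrableOn F K μ) {G : ℕ → E → V} {G₀ : E → V}
    (hGc : ∀ n, Continuous (G n)) (hG₀c : Continuous G₀)
    (hGK : ∀ n, ∀ x ∉ K, G n x = 0) (hG₀K : ∀ x ∉ K, G₀ x = 0)
    (hdist : ∀ n x, dist (G n x) (G₀ x) ≤ 1 / ((n : ℝ) + 1)) :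
    Tendsto (fun n => ∫ x in Ω, inner ℝ (F x) (G n x) ∂μ) atTop
      (𝓝 (∫ x in Ω, inner ℝ (F x) (G₀ x) ∂μ)) := by
  have red : ∀ g : E → V, (∀ x ∉ K, g x = 0) →
      ∫ x in Ω, inner ℝ (F x) (g x) ∂μ = ∫ x in K, inner ℝ (F x) (g x) ∂μ := fun g hg =>
    setIntegral_eq_of_subset_of_forall_sdiff_eq_zero hΩ hKΩ
      fun x hx => by rw [hg x hx.2, inner_zero_right]
  rw [red G₀ hG₀K]
  simp_rw [fun n => red (G n) (hGK n)]
  obtain ⟨C, hC⟩ := hK.exists_bound_of_continuousOn hG₀c.continuousOn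
  refine tendsto_integral_of_dominated_convergence (fun x => ‖F x‖ * (C + 1))
    (fun n => hF.aestronglyMeasurable.inner
      ((hGc n).continuousOn.aestronglyMeasurable_of_isCompact hK hK.measurableSet))
    (hF.norm.mul_const _) (fun n => ?_) ?_
  · filter_upwards [ae_restrict_mem hK.measurableSet] with x hx
    refine (norm_inner_le_norm _ _).trans (mul_le_mul_of_nonneg_left ?_ (norm_nonneg _))
    have h1 : dist (G n x) (G₀ x) ≤ 1 := (hdist n x).trans <| by
      rw [div_le_one (by positivity)]
      linarith [Nat.cast_nonneg (α := ℝ) n]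
    have h2 : ‖G n x‖ ≤ ‖G₀ x‖ + ‖G n x - G₀ x‖ := norm_le_norm_add_norm_sub' _ _
    rw [dist_eq_norm] at h1
    linarith [hC x hx]
  · refine Eventually.of_forall fun x => ?_
    have : Tendsto (fun n => G n x) atTop (𝓝 (G₀ x)) :=
      tendsto_iff_dist_tendsto_zero.2 (squeeze_zero (fun _ => dist_nonneg) (fun n => hdist n x)
        tendsto_one_div_add_atTop_nhds_zero_nat)
    exact tendsto_const_nhds.inner this

section Approximation

variable {E : Type*} [NormedAddCommGroup E] [InnerProductSpace ℝ E] [FiniteDimensional ℝ E]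

/-- A compactly supported `C¹` function is uniformly close, with its derivative, to a smooth
function supported near its support. -/
theorem exists_contDiff_close_of_hasCompactSupport {ψ : E → ℝ} (hψ : ContDiff ℝ 1 ψ)
    (hc : HasCompactSupport ψ) {δ ε : ℝ} (hδ : 0 < δ) (hε : 0 < ε) :
    ∃ χ : E → ℝ, ContDiff ℝ ((⊤ : ℕ∞) : WithTop ℕ∞) χ ∧
      tsupport χ ⊆ Metric.cthickening δ (tsupport ψ) ∧
      (∀ x, dist (χ x) (ψ x) ≤ ε) ∧ ∀ x, dist (fderiv ℝ χ x) (fderiv ℝ ψ x) ≤ ε := by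
  borelize E
  have hdψ : Continuous (fderiv ℝ ψ) := hψ.continuous_fderiv one_ne_zero
  have u1 := hc.uniformContinuous_of_continuous hψ.continuous
  have u2 := (hc.fderiv ℝ).uniformContinuous_of_continuous hdψ
  obtain ⟨a, ha, h1⟩ := Metric.uniformContinuous_iff.1 u1 ε hε
  obtain ⟨b, hb, h2⟩ := Metric.uniformContinuous_iff.1 u2 ε hε
  -- The mollification radius: `δ` controls the support, `a` and `b` the oscillation of `ψ` and of
  -- its derivative.
  set r := min δ (min a b) with hr
  have hr0 : 0 < r := lt_min hδ (lt_min ha hb)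
  let φ : ContDiffBump (0 : E) := ⟨r / 2, r, half_pos hr0, half_lt_self hr0⟩
  let μ : Measure E := Measure.addHaar
  let χ : E → ℝ := convolution (φ.normed μ) ψ (ContinuousLinearMap.lsmul ℝ ℝ) μ
  have hloc : LocallyIntegrable ψ μ := hψ.continuous.locallyIntegrable
  have hder : ∀ x, fderiv ℝ χ x =
      convolution (φ.normed μ) (fderiv ℝ ψ) (ContinuousLinearMap.lsmul ℝ ℝ) μ x := fun x =>
    (hc.hasFDerivAt_convolution_right (ContinuousLinearMap.lsmul ℝ ℝ)
      φ.continuous_normed.locallyIntegrable hψ x).fderiv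
  refine ⟨χ, φ.hasCompactSupport_normed.contDiff_convolution_left _ φ.contDiff_normed hloc,
    ?_, fun x => ?_, fun x => ?_⟩
  · refine closure_minimal (fun x hx => ?_) Metric.isClosed_cthickening
    by_contra hxn
    have hz : ∀ y, dist y x < r → ψ y = 0 := fun y hy => by
      by_contra hy0
      exact hxn (Metric.mem_cthickening_of_dist_le x y δ _ (subset_tsupport _ hy0)
        (by rw [dist_comm]; exact hy.le.trans (min_le_left _ _)))
    -- As `ψ` vanishes on the ball of radius `r` about `x`, the closeness estimate with `ε = 0`
    -- forces `χ x = 0`.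
    have := φ.dist_normed_convolution_le (μ := μ) (g := ψ) (x₀ := x) (ε := 0)
      hψ.continuous.aestronglyMeasurable
      (fun y hy => by rw [hz y hy, hz x (by simpa using hr0)]; simp)
    rw [hz x (by simpa using hr0)] at this
    exact hx (dist_le_zero.1 this)
  · exact φ.dist_normed_convolution_le hψ.continuous.aestronglyMeasurable
      fun y hy => (h1 (lt_of_lt_of_le hy ((min_le_right _ _).trans (min_le_left _ _)))).le
  · rw [hder]
    exact φ.dist_normed_convolution_le hdψ.aestronglyMeasurable
      fun y hy => (h2 (lt_of_lt_of_le hy ((min_le_right _ _).trans (min_le_right _ _)))).le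

theorem dist_gradient (χ ψ : E → ℝ) (x : E) :
    dist (gradient χ x) (gradient ψ x) = dist (fderiv ℝ χ x) (fderiv ℝ ψ x) :=
  (InnerProductSpace.toDual ℝ E).symm.dist_map _ _

theorem ContDiff.continuous_gradient {ψ : E → ℝ} (hψ : ContDiff ℝ 1 ψ) :
    Continuous (gradient ψ) :=
  (InnerProductSpace.toDual ℝ E).symm.continuous.comp (hψ.continuous_fderiv one_ne_zero)

theorem ContDiffOn.continuousOn_gradient {Ω : Set E} {u : E → ℝ} (hu : ContDiffOn ℝ 1 u Ω)
    (hΩ : IsOpen Ω) : ContinuousOn (gradient u) Ω :=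
  (InnerProductSpace.toDual ℝ E).symm.continuous.comp_continuousOn
    (hu.continuousOn_fderiv_of_isOpen hΩ le_rfl)

theorem gradient_eq_zero_of_notMem_tsupport {ψ : E → ℝ} {x : E} (hx : x ∉ tsupport ψ) :
    gradient ψ x = 0 := by
  have h : ψ =ᶠ[𝓝 x] fun _ => (0 : ℝ) := notMem_tsupport_iff_eventuallyEq.1 hx
  rw [h.gradient_eq, gradient_fun_const]

variable [MeasurableSpace E] [BorelSpace E] {μ : Measure E}

/-- An identity between integrals that is linear in the test function and its gradient passes
from smooth to `C¹` compactly supported test functions. -/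
theorem weak_identity_of_contDiff_one {Ω : Set E} (hΩ : IsOpen Ω) {F : E → E} {h k : E → ℝ}
    (hF : ∀ K, IsCompact K → K ⊆ Ω → IntegrableOn F K μ)
    (hh : ∀ K, IsCompact K → K ⊆ Ω → IntegrableOn h K μ)
    (hk : ∀ K, IsCompact K → K ⊆ Ω → IntegrableOn k K μ)
    (H : ∀ χ : E → ℝ, ContDiff ℝ ((⊤ : ℕ∞) : WithTop ℕ∞) χ → HasCompactSupport χ →
      tsupport χ ⊆ Ω → (∫ x in Ω, inner ℝ (F x) (gradient χ x) ∂μ) + ∫ x in Ω, h x * χ x ∂μ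
        = ∫ x in Ω, k x * χ x ∂μ)
    {ψ : E → ℝ} (hψ : ContDiff ℝ 1 ψ) (hc : HasCompactSupport ψ) (hs : tsupport ψ ⊆ Ω) :
    (∫ x in Ω, inner ℝ (F x) (gradient ψ x) ∂μ) + ∫ x in Ω, h x * ψ x ∂μ
        = ∫ x in Ω, k x * ψ x ∂μ := by
  obtain ⟨δ, hδ, hδΩ⟩ := hc.isCompact.exists_cthickening_subset_open hΩ hs
  set K := Metric.cthickening δ (tsupport ψ) with hKdef
  have hK : IsCompact K := hc.isCompact.cthickening
  choose χ hχ hχK hχ0 hχ1 using fun n : ℕ =>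
    exists_contDiff_close_of_hasCompactSupport hψ hc hδ
      (show (0 : ℝ) < 1 / ((n : ℝ) + 1) by positivity)
  have hψK : tsupport ψ ⊆ K := Metric.self_subset_cthickening _
  have hχ' : ∀ n, ContDiff ℝ 1 (χ n) := fun n => (hχ n).of_le (by exact_mod_cast le_top)
  have hcomp : ∀ n, HasCompactSupport (χ n) := fun n =>
    hK.of_isClosed_subset (isClosed_tsupport _) (hχK n)
  have t1 := tendsto_setIntegral_inner_of_dist_le (μ := μ) hΩ.measurableSet hK hδΩ
    (hF K hK hδΩ) (fun n => (hχ' n).continuous_gradient) hψ.continuous_gradient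
    (fun n x hx => gradient_eq_zero_of_notMem_tsupport fun h => hx (hχK n h))
    (fun x hx => gradient_eq_zero_of_notMem_tsupport fun h => hx (hψK h))
    (fun n x => (dist_gradient _ _ x).trans_le (hχ1 n x))
  have t2 : ∀ q : E → ℝ, IntegrableOn q K μ →
      Tendsto (fun n => ∫ x in Ω, q x * χ n x ∂μ) atTop (𝓝 (∫ x in Ω, q x * ψ x ∂μ)) := by
    intro q hq
    have := tendsto_setIntegral_inner_of_dist_le (μ := μ) hΩ.measurableSet hK hδΩ
      hq (fun n => (hχ' n).continuous) hψ.continuous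
      (fun n x hx => image_eq_zero_of_notMem_tsupport fun h => hx (hχK n h))
      (fun x hx => image_eq_zero_of_notMem_tsupport fun h => hx (hψK h))
      (fun n x => hχ0 n x)
    simpa [mul_comm] using this
  refine tendsto_nhds_unique (t1.add (t2 h (hh K hK hδΩ))) ?_
  simp_rw [fun n => H (χ n) (hχ n) (hcomp n) ((hχK n).trans hδΩ)]
  exact t2 k (hk K hK hδΩ)

end Approximation

/-! ### Sobolev inequality on sets of small measure. -/

section SmallSupport

/-- A `C¹` function supported in a set of small measure has small `L¹` norm compared to that of
its derivative. -/
theorem exists_lintegral_enorm_le_volume_rpow_mul {N : ℕ} (hN : 2 ≤ N) :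
    ∃ C : ℝ≥0, ∀ (U : Set (EuclideanSpace ℝ (Fin N))) (h : EuclideanSpace ℝ (Fin N) → ℝ),
      MeasurableSet U → ContDiff ℝ 1 h → HasCompactSupport h → tsupport h ⊆ U →
      ∫⁻ x in U, ‖h x‖ₑ ≤ C * volume U ^ (1 / (N : ℝ)) * ∫⁻ x in U, ‖gradient h x‖ₑ := by
  have hN1 : (1 : ℝ) < N := by exact_mod_cast hN
  obtain ⟨p, hp⟩ : ∃ p : ℝ≥0, NNReal.HolderConjugate (N : ℝ≥0) p :=
    ⟨_, NNReal.HolderConjugate.conjExponent (by exact_mod_cast hN)⟩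
  set V := EuclideanSpace ℝ (Fin N)
  -- Gagliardo–Nirenberg–Sobolev bounds the `L^p` norm with `p = N / (N - 1)`; Hölder's inequality
  -- on `U` then costs the power `1 - 1/p = 1/N` of the volume.
  refine ⟨eLpNormLESNormFDerivOneConst (volume : Measure V) p, fun U h hU hh hc hs => ?_⟩
  have hp' : NNReal.HolderConjugate (Module.finrank ℝ V : ℝ≥0) p := by
    simpa [V] using hp
  have h1 := eLpNorm_le_eLpNorm_fderiv_one (volume : Measure V) hh hc hp'
  have hp1 : (1 : ℝ≥0∞) ≤ p := by exact_mod_cast hp.symm.lt.le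
  have h2 := eLpNorm_le_eLpNorm_mul_rpow_measure_univ (μ := volume.restrict U) hp1
    (f := h) hh.continuous.aestronglyMeasurable
  have he : 1 / (1 : ℝ≥0∞).toReal - 1 / (p : ℝ≥0∞).toReal = 1 / (N : ℝ) := by
    have := hp.coe.inv_add_inv_eq_one
    simp only [ENNReal.toReal_one, ENNReal.coe_toReal, one_div]
    push_cast at this
    linarith
  rw [he, eLpNorm_one_eq_lintegral_enorm, Measure.restrict_apply_univ] at h2
  have h3 : ∫⁻ x in U, ‖gradient h x‖ₑ = eLpNorm (fderiv ℝ h) 1 volume := by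
    rw [eLpNorm_one_eq_lintegral_enorm, ← lintegral_indicator hU]
    refine lintegral_congr fun x => ?_
    have e : ‖gradient h x‖ₑ = ‖fderiv ℝ h x‖ₑ := by
      rw [← toDual_gradient, LinearIsometryEquiv.enorm_map]
    by_cases hx : x ∈ U
    · rw [indicator_of_mem hx, e]
    · rw [indicator_of_notMem hx, ← e,
        gradient_eq_zero_of_notMem_tsupport fun h' => hx (hs h'), enorm_zero]
  rw [h3]
  calc _ ≤ _ := h2
    _ ≤ (eLpNormLESNormFDerivOneConst (volume : Measure V) p * eLpNorm (fderiv ℝ h) 1 volume) *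
        volume U ^ (1 / (N : ℝ)) := by
      gcongr
      exact (eLpNorm_restrict_le _ _ _ _).trans h1
    _ = _ := by rw [mul_right_comm]

end SmallSupport

/-! ### Sequences of functions in `L²`. -/

section Completeness

theorem lintegral_enorm_sq_eq_eLpNorm_sq {α V : Type*} [MeasurableSpace α]
    [NormedAddCommGroup V] {μ : Measure α} (g : α → V) :
    ∫⁻ x, ‖g x‖ₑ ^ 2 ∂μ = eLpNorm g 2 μ ^ 2 := by
  rw [eLpNorm_eq_lintegral_rpow_enorm_toReal (by simp) (by simp), ← ENNReal.rpow_natCast,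
    ← ENNReal.rpow_mul]
  simp

theorem tendsto_eLpNorm_of_tendsto_lintegral_enorm_sq {α V ι : Type*} [MeasurableSpace α]
    [NormedAddCommGroup V] {μ : Measure α} {l : Filter ι} {g : ι → α → V}
    (h : Tendsto (fun i => ∫⁻ x, ‖g i x‖ₑ ^ 2 ∂μ) l (𝓝 0)) :
    Tendsto (fun i => eLpNorm (g i) 2 μ) l (𝓝 0) := by
  have h' := h.ennrpow_const (2⁻¹ : ℝ)
  rw [ENNReal.zero_rpow_of_pos (by norm_num)] at h'
  refine h'.congr fun i => ?_
  rw [lintegral_enorm_sq_eq_eLpNorm_sq, ← ENNReal.rpow_natCast, ← ENNReal.rpow_mul]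
  simp

/-- Completeness of `L²`, for sequences of functions. -/
theorem exists_tendsto_lintegral_enorm_sub_sq {α V : Type*} [MeasurableSpace α]
    [NormedAddCommGroup V] [CompleteSpace V] {μ : Measure α} {φ : ℕ → α → V}
    (hm : ∀ n, MemLp (φ n) 2 μ)
    (hc : Tendsto (fun p : ℕ × ℕ => ∫⁻ x, ‖φ p.1 x - φ p.2 x‖ₑ ^ 2 ∂μ) atTop (𝓝 0)) :
    ∃ w : α → V, StronglyMeasurable w ∧
      Tendsto (fun n => ∫⁻ x, ‖φ n x - w x‖ₑ ^ 2 ∂μ) atTop (𝓝 0) := by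
  have hcs : CauchySeq fun n => (hm n).toLp (φ n) := by
    rw [Lp.cauchySeq_Lp_iff_cauchySeq_eLpNorm]
    refine (tendsto_eLpNorm_of_tendsto_lintegral_enorm_sq hc).congr fun p => ?_
    refine eLpNorm_congr_ae ?_
    filter_upwards [(hm p.1).coeFn_toLp, (hm p.2).coeFn_toLp] with x hx hy
    simp [hx, hy]
  obtain ⟨w, hw⟩ := cauchySeq_tendsto_of_complete hcs
  refine ⟨w, Lp.stronglyMeasurable w, ?_⟩
  have h1 := tendsto_iff_edist_tendsto_0.1 hw
  have h2 := ENNReal.Tendsto.pow (n := 2) h1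
  rw [zero_pow two_ne_zero] at h2
  refine h2.congr fun n => ?_
  rw [Lp.edist_def, ← lintegral_enorm_sq_eq_eLpNorm_sq]
  refine lintegral_congr_ae ?_
  filter_upwards [(hm n).coeFn_toLp] with x hx
  simp [hx]

end Completeness

/-! ### From test functions to the completion. -/

section Reduction

variable {N : ℕ} {ρ : EuclideanSpace ℝ (Fin N) → ℝ} {U D : Set (EuclideanSpace ℝ (Fin N))}

/-- Turns the energy into a squared `L²` norm for the measure `ρ dx`, where completeness and the
triangle inequality are available. -/
theorem energy_eq_lintegral_withDensity (hρ : AEMeasurable ρ (volume.restrict U))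
    {g : EuclideanSpace ℝ (Fin N) → EuclideanSpace ℝ (Fin N)}
    (hg : AEStronglyMeasurable g (volume.restrict U)) :
    energy ρ U g =
      ∫⁻ x, ‖g x‖ₑ ^ 2 ∂(volume.restrict U).withDensity fun x => ENNReal.ofReal (ρ x) := by
  rw [lintegral_withDensity_eq_lintegral_mul₀ hρ.ennreal_ofReal (hg.enorm.pow_const 2)]
  rfl

theorem tendsto_lintegral_enorm_sq {α V : Type*} [MeasurableSpace α]
    [NormedAddCommGroup V] {μ : Measure α} {φ : ℕ → α → V} {g : α → V}
    (hφ : ∀ n, AEStronglyMeasurable (φ n) μ) (hg : AEStronglyMeasurable g μ)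
    (h : Tendsto (fun n => ∫⁻ x, ‖φ n x - g x‖ₑ ^ 2 ∂μ) atTop (𝓝 0)) :
    Tendsto (fun n => ∫⁻ x, ‖φ n x‖ₑ ^ 2 ∂μ) atTop (𝓝 (∫⁻ x, ‖g x‖ₑ ^ 2 ∂μ)) := by
  simp_rw [lintegral_enorm_sq_eq_eLpNorm_sq]
  refine ENNReal.Tendsto.pow ?_
  have h0 : Tendsto (fun n => eLpNorm (φ n - g) 2 μ) atTop (𝓝 0) :=
    tendsto_eLpNorm_of_tendsto_lintegral_enorm_sq h
  have hlow := ENNReal.Tendsto.sub (tendsto_const_nhds (x := eLpNorm g 2 μ)) h0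
    (Or.inr ENNReal.zero_ne_top)
  have hup := (tendsto_const_nhds (x := eLpNorm g 2 μ)).add h0
  rw [tsub_zero] at hlow
  rw [add_zero] at hup
  refine tendsto_of_tendsto_of_tendsto_of_le_of_le hlow hup (fun n => ?_) fun n => ?_
  · rw [tsub_le_iff_right, add_comm]
    calc eLpNorm g 2 μ = eLpNorm (φ n - (φ n - g)) 2 μ := by rw [sub_sub_cancel]
      _ ≤ eLpNorm (φ n) 2 μ + eLpNorm (φ n - g) 2 μ :=
          eLpNorm_sub_le (hφ n) ((hφ n).sub hg) (by norm_num)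
      _ = _ := add_comm _ _
  · calc eLpNorm (φ n) 2 μ = eLpNorm (g + (φ n - g)) 2 μ := by rw [add_sub_cancel]
      _ ≤ _ := eLpNorm_add_le hg ((hφ n).sub hg) (by norm_num)

namespace IsTestFun

variable {φ χ : EuclideanSpace ℝ (Fin N) → ℝ}

theorem contDiff_one (h : IsTestFun U φ) : ContDiff ℝ 1 φ :=
  h.smooth.of_le (by exact_mod_cast le_top)

theorem differentiable (h : IsTestFun U φ) : Differentiable ℝ φ :=
  h.contDiff_one.differentiable one_ne_zero

theorem sub (h : IsTestFun U φ) (h' : IsTestFun U χ) : IsTestFun U (φ - χ) where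
  smooth := h.smooth.sub h'.smooth
  compact := h.compact.sub h'.compact
  subset := (tsupport_sub φ χ).trans (union_subset h.subset h'.subset)

theorem gradient_sub (h : IsTestFun U φ) (h' : IsTestFun U χ) :
    gradient (φ - χ) = fun x => gradient φ x - gradient χ x := by
  ext1 x
  simp [gradient, fderiv_sub (h.differentiable x) (h'.differentiable x)]

theorem memLp (h : IsTestFun U φ) : MemLp φ 2 (volume.restrict U) :=
  h.contDiff_one.continuous.memLp_of_hasCompactSupport h.compact

end IsTestFun

/-- The weighted Poincaré inequality follows from its validity on test functions. -/
theorem weightedPoincare_of_isFiniteTestFun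
    (hρ : ∀ U, IsOpen U → U ⊆ D → AEMeasurable ρ (volume.restrict U))
    (hfin : ∃ C : ℝ≥0, ∀ U, IsOpen U → U ⊆ D → ∀ φ, IsFiniteTestFun ρ U φ →
      ∫⁻ x in U, ‖φ x‖ₑ ^ 2 ≤ C * energy ρ U (gradient φ))
    (hsmall : ∀ ε : ℝ≥0, 0 < ε → ∃ δ : ℝ≥0, 0 < δ ∧ ∀ U, IsOpen U → U ⊆ D → volume U ≤ δ →
      ∀ φ, IsFiniteTestFun ρ U φ →
        ∫⁻ x in U, ‖φ x‖ₑ ^ 2 ≤ ε * energy ρ U (gradient φ)) :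
    WeightedPoincare ρ D := by
  obtain ⟨C, hC⟩ := hfin
  -- The admissible constants. `CP U` is their infimum, which is attained and inherits every bound
  -- valid for test functions, in particular both `C` and `ε`.
  let S : Set (EuclideanSpace ℝ (Fin N)) → Set ℝ≥0 := fun U =>
    {c | ∀ φ, IsFiniteTestFun ρ U φ → ∫⁻ x in U, ‖φ x‖ₑ ^ 2 ≤ c * energy ρ U (gradient φ)}
  have hSclosed : ∀ U, IsClosed (S U) := fun U => by
    have : S U = ⋂ φ, ⋂ _ : IsFiniteTestFun ρ U φ,
        {c : ℝ≥0 | ∫⁻ x in U, ‖φ x‖ₑ ^ 2 ≤ c * energy ρ U (gradient φ)} := by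
      ext c; simp [S]
    rw [this]
    refine isClosed_iInter fun φ => isClosed_iInter fun hφ => isClosed_le continuous_const ?_
    -- Finiteness of the energy is what makes multiplication by it continuous.
    exact (ENNReal.continuous_mul_const hφ.2).comp ENNReal.continuous_coe
  have hmem : ∀ U, IsOpen U → U ⊆ D → sInf (S U) ∈ S U := fun U hU hUD =>
    (hSclosed U).csInf_mem ⟨C, hC U hU hUD⟩ (OrderBot.bddBelow _)
  refine ⟨fun U => sInf (S U), fun U hU hUD => ⟨fun φ hφ => ?_, fun w g hwg => ?_⟩, ?_⟩
  · obtain ⟨hφt, hφc⟩ := hφ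
    have hgm : ∀ n, AEStronglyMeasurable (gradient (φ n)) (volume.restrict U) := fun n =>
      (hφt n).1.contDiff_one.continuous_gradient.aestronglyMeasurable
    set ν := (volume.restrict U).withDensity fun x => ENNReal.ofReal (ρ x)
    have hac : ν ≪ volume.restrict U := withDensity_absolutelyContinuous _ _
    obtain ⟨g, hg, hgt⟩ := exists_tendsto_lintegral_enorm_sub_sq (μ := ν)
      (φ := fun n => gradient (φ n))
      (fun n => ⟨(hgm n).mono_ac hac, by
        have := (hφt n).2
        rw [energy_eq_lintegral_withDensity (hρ U hU hUD) (hgm n),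
          lintegral_enorm_sq_eq_eLpNorm_sq] at this
        exact lt_top_iff_ne_top.2 fun h => this (by rw [h]; rfl)⟩)
      (hφc.congr fun p => energy_eq_lintegral_withDensity (hρ U hU hUD)
        ((hgm p.1).sub (hgm p.2)))
    have hgt' : Tendsto (fun n => energy ρ U (fun x => gradient (φ n) x - g x)) atTop (𝓝 0) :=
      hgt.congr fun n => (energy_eq_lintegral_withDensity (hρ U hU hUD)
        ((hgm n).sub hg.aestronglyMeasurable)).symm
    have hL : Tendsto (fun p : ℕ × ℕ => ∫⁻ x in U, ‖φ p.1 x - φ p.2 x‖ₑ ^ 2) atTop (𝓝 0) := by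
      have hC0 : Tendsto (fun p : ℕ × ℕ =>
          C * energy ρ U (fun x => gradient (φ p.1) x - gradient (φ p.2) x)) atTop (𝓝 0) := by
        simpa using ENNReal.Tendsto.const_mul hφc (Or.inr (ENNReal.coe_ne_top (r := C)))
      refine tendsto_of_tendsto_of_tendsto_of_le_of_le' tendsto_const_nhds hC0
        (Eventually.of_forall fun _ => zero_le) ?_
      -- The inequality is applied to differences of the sequence, whose energies tend to zero and
      -- so are eventually finite.
      filter_upwards [hφc.eventually (gt_mem_nhds ENNReal.zero_lt_top)] with p hp
      have ht := (hφt p.1).1.sub (hφt p.2).1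
      have hgr := (hφt p.1).1.gradient_sub (hφt p.2).1
      have := hC U hU hUD _ ⟨ht, by rw [hgr]; exact hp.ne⟩
      rwa [hgr] at this
    obtain ⟨w, hw, hwt⟩ := exists_tendsto_lintegral_enorm_sub_sq (fun n => (hφt n).1.memLp) hL
    refine ⟨w, g, ⟨hw.aestronglyMeasurable, hg.aestronglyMeasurable, φ, hφt, hgt', ?_⟩, hwt, hgt'⟩
    refine tendstoInMeasure_of_tendsto_eLpNorm (p := 2) (by simp)
      (fun n => (hφt n).1.memLp.1) hw.aestronglyMeasurable
      (tendsto_eLpNorm_of_tendsto_lintegral_enorm_sq hwt)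
  · obtain ⟨hw, hg, φ, hφ, hφg, hφw⟩ := hwg
    have hgm : ∀ n, AEStronglyMeasurable (gradient (φ n)) (volume.restrict U) := fun n =>
      (hφ n).1.contDiff_one.continuous_gradient.aestronglyMeasurable
    set ν := (volume.restrict U).withDensity fun x => ENNReal.ofReal (ρ x)
    have hac : ν ≪ volume.restrict U := withDensity_absolutelyContinuous _ _
    have hE : Tendsto (fun n => energy ρ U (gradient (φ n))) atTop (𝓝 (energy ρ U g)) := by
      rw [energy_eq_lintegral_withDensity (hρ U hU hUD) hg]
      refine (tendsto_lintegral_enorm_sq (μ := ν) (fun n => (hgm n).mono_ac hac)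
        (hg.mono_ac hac) ?_).congr
        fun n => (energy_eq_lintegral_withDensity (hρ U hU hUD) (hgm n)).symm
      exact hφg.congr fun n => energy_eq_lintegral_withDensity (hρ U hU hUD) ((hgm n).sub hg)
    -- Along an a.e. convergent subsequence, Fatou's lemma on the left meets convergence of the
    -- energies on the right.
    obtain ⟨ns, hns, hae⟩ := hφw.exists_seq_tendsto_ae
    have hE' := ENNReal.Tendsto.const_mul (hE.comp hns.tendsto_atTop)
      (Or.inr (ENNReal.coe_ne_top (r := (sInf (S U) : ℝ≥0))))
    calc ∫⁻ x in U, ‖w x‖ₑ ^ 2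
        ≤ ∫⁻ x in U, liminf (fun n => ‖φ (ns n) x‖ₑ ^ 2) atTop := by
          refine lintegral_mono_ae ?_
          filter_upwards [hae] with x hx
          exact (ENNReal.Tendsto.pow (n := 2) hx.enorm).liminf_eq.ge
      _ ≤ liminf (fun n => ∫⁻ x in U, ‖φ (ns n) x‖ₑ ^ 2) atTop :=
          lintegral_liminf_le' fun n => (hφ (ns n)).1.memLp.1.enorm.pow_const 2
      _ ≤ liminf (fun n => ((sInf (S U) : ℝ≥0) : ℝ≥0∞) * energy ρ U (gradient (φ (ns n)))) atTop :=
          liminf_le_liminf (Eventually.of_forall fun n => hmem U hU hUD _ (hφ (ns n)))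
      _ = _ := hE'.liminf_eq
  · intro ε hε
    obtain ⟨δ, hδ, h⟩ := hsmall ε hε
    exact ⟨δ, hδ, fun U hU hUD hv => csInf_le (OrderBot.bddBelow _) (h U hU hUD hv)⟩

end Reduction

/-! ### Consequences of the structural conditions. -/

section Coefficients

variable {A B : ℝ → ℝ}

namespace IsCoeffA

theorem continuousOn_Ioi (hA : IsCoeffA A) : ContinuousOn A (Ioi 0) :=
  hA.contDiffOn.continuousOn

/-- Near zero this is the limsup condition, away from zero compactness; at zero the factor `t`
removes the arbitrary value `A 0`. -/
theorem exists_mul_le (hA : IsCoeffA A) (T : ℝ) :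
    ∃ C : ℝ, 0 ≤ C ∧ ∀ t ∈ Icc 0 T, A t * t ≤ C := by
  obtain ⟨b, hb⟩ := hA.limsup_lt
  rw [eventually_map, eventually_nhdsWithin_iff, Metric.eventually_nhds_iff] at hb
  obtain ⟨ε, hε, hb⟩ := hb
  obtain ⟨C, hC⟩ := (isCompact_Icc (a := ε / 2) (b := T)).exists_bound_of_continuousOn
    (f := fun t => A t * t)
    ((hA.continuousOn_Ioi.mono fun t ht => lt_of_lt_of_le (half_pos hε) ht.1).mul continuousOn_id)
  refine ⟨max 0 (max b C), le_max_left _ _, fun t ht => ?_⟩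
  rcases ht.1.eq_or_lt with rfl | h0
  · simp
  rcases lt_or_ge t (ε / 2) with h | h
  · have := hb (y := t) (by rw [Real.dist_eq, sub_zero, abs_of_pos h0]; linarith) h0
    rw [mul_comm]
    exact this.trans ((le_max_left _ _).trans (le_max_right _ _))
  · exact ((le_abs_self _).trans (hC t ⟨h, ht.2⟩)).trans
      ((le_max_right _ _).trans (le_max_right _ _))

theorem mul_nonneg (hA : IsCoeffA A) {t : ℝ} (ht : 0 ≤ t) : 0 ≤ A t * t := by
  rcases ht.eq_or_lt with rfl | h
  · simp
  · exact (mul_pos (hA.pos t h) h).le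

/-- Continuity at zero holds because `A t * t ^ 2 ≤ C * t` there, even if `A` blows up. -/
theorem continuousOn_mul_sq (hA : IsCoeffA A) : ContinuousOn (fun t => A t * t ^ 2) (Ici 0) := by
  intro t ht
  rcases (mem_Ici.1 ht).eq_or_lt with rfl | h
  · obtain ⟨C, hC0, hC⟩ := hA.exists_mul_le 1
    have hlim : Tendsto (fun t : ℝ => C * t) (𝓝[Ici 0] 0) (𝓝 0) := by
      have : Tendsto (fun t : ℝ => C * t) (𝓝 0) (𝓝 (C * 0)) :=
        (continuous_const.mul continuous_id).tendsto _
      rw [mul_zero] at this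
      exact this.mono_left nhdsWithin_le_nhds
    have : Tendsto (fun t : ℝ => A t * t ^ 2) (𝓝[Ici 0] 0) (𝓝 0) := by
      refine tendsto_of_tendsto_of_tendsto_of_le_of_le' tendsto_const_nhds hlim ?_ ?_
      · filter_upwards [self_mem_nhdsWithin] with t ht
        have := _root_.mul_nonneg (hA.mul_nonneg ht) ht
        nlinarith
      · filter_upwards [self_mem_nhdsWithin, mem_nhdsWithin_of_mem_nhds (Iic_mem_nhds one_pos)]
          with t ht ht1
        have := mul_le_mul_of_nonneg_right (hC t ⟨ht, ht1⟩) ht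
        nlinarith
    simpa [ContinuousWithinAt] using this
  · exact ((hA.continuousOn_Ioi.continuousAt (Ioi_mem_nhds h)).mul
      (continuousAt_id.pow 2)).continuousWithinAt

theorem aemeasurable_comp_norm {α V : Type*} [MeasurableSpace α] [NormedAddCommGroup V]
    (hA : IsCoeffA A) {μ : Measure α} {g : α → V} (hg : AEStronglyMeasurable g μ) :
    AEMeasurable (fun x => A ‖g x‖) μ := by
  classical
  have hm : Measurable ((Ioi (0 : ℝ)).piecewise A fun _ => A 0) :=
    hA.continuousOn_Ioi.measurable_piecewise continuousOn_const measurableSet_Ioi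
  refine (hm.comp_aemeasurable hg.norm.aemeasurable).congr (Eventually.of_forall fun x => ?_)
  rcases (norm_nonneg (g x)).eq_or_lt with h | h
  · simp [← h]
  · simp [piecewise, h]

end IsCoeffA

/-- A function that is positive on the zeros of a nonnegative one becomes bounded below by a
positive constant after adding a large multiple of the latter. -/
theorem IsCompact.exists_pos_le_add_mul {X : Type*} [TopologicalSpace X] [T2Space X] {K : Set X}
    (hK : IsCompact K) {p q : X → ℝ} (hp : ContinuousOn p K) (hq : ContinuousOn q K)
    (hq0 : ∀ x ∈ K, 0 ≤ q x) (hpq : ∀ x ∈ K, q x = 0 → 0 < p x) :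
    ∃ l c : ℝ, 0 ≤ l ∧ 0 < c ∧ ∀ x ∈ K, c ≤ p x + l * q x := by
  have hS : IsCompact (K ∩ p ⁻¹' Iic 0) :=
    hK.of_isClosed_subset (hp.preimage_isClosed_of_isClosed hK.isClosed isClosed_Iic)
      inter_subset_left
  obtain ⟨a, ha, haS⟩ := hS.exists_forall_le' (hq.mono inter_subset_left) (a := 0)
    fun x hx => (hq0 x hx.1).lt_of_ne fun h => (hpq x hx.1 h.symm).not_ge hx.2
  obtain ⟨M, hM⟩ := hK.exists_bound_of_continuousOn hp
  -- Where `p ≤ 0` one has `q ≥ a`, so this multiple of `q` is at least `max M 0 + 1`, which exceeds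
  -- `-p`.
  have hl : 0 ≤ (max M 0 + 1) / a := by positivity
  obtain ⟨c, hc, hcK⟩ := hK.exists_forall_le'
    (hp.add (continuousOn_const (c := (max M 0 + 1) / a) |>.mul hq)) (a := 0) fun x hx => by
      rcases le_or_gt (p x) 0 with h | h
      · have h1 := mul_le_mul_of_nonneg_left (haS x ⟨hx, h⟩) hl
        rw [div_mul_cancel₀ _ ha.ne'] at h1
        have h2 := (abs_le.1 (hM x hx)).1
        have h3 := le_max_left M 0
        change 0 < p x + (max M 0 + 1) / a * q x
        linarith
      · exact add_pos_of_pos_of_nonneg h (mul_nonneg hl (hq0 x hx))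
  exact ⟨_, c, hl, hc, hcK⟩

end Coefficients

/-! ### The energy as a real integral, and the region away from critical points. -/

section Estimates

variable {N : ℕ}

/-- The truncation `max (ρ x) 0` matches `ENNReal.ofReal`: at critical points `ρ` equals `A 0`,
which may be negative. -/
theorem IsFiniteTestFun.integrableOn_and_energy_eq {ρ : EuclideanSpace ℝ (Fin N) → ℝ}
    {U : Set (EuclideanSpace ℝ (Fin N))} {φ : EuclideanSpace ℝ (Fin N) → ℝ}
    (hρ : AEMeasurable ρ (volume.restrict U)) (hφ : IsFiniteTestFun ρ U φ) :
    IntegrableOn (fun x => max (ρ x) 0 * ‖gradient φ x‖ ^ 2) U ∧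
      energy ρ U (gradient φ) =
        ENNReal.ofReal (∫ x in U, max (ρ x) 0 * ‖gradient φ x‖ ^ 2) := by
  have h0 : ∀ x, 0 ≤ max (ρ x) 0 * ‖gradient φ x‖ ^ 2 := fun x => by positivity
  have he : energy ρ U (gradient φ) =
      ∫⁻ x in U, ENNReal.ofReal (max (ρ x) 0 * ‖gradient φ x‖ ^ 2) := by
    refine lintegral_congr fun x => ?_
    have : ENNReal.ofReal (max (ρ x) 0) = ENNReal.ofReal (ρ x) := by
      simp [ENNReal.ofReal_max]
    rw [ENNReal.ofReal_mul (le_max_right _ _), this, ENNReal.ofReal_pow (norm_nonneg _),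
      ofReal_norm]
  have hi : IntegrableOn (fun x => max (ρ x) 0 * ‖gradient φ x‖ ^ 2) U := by
    refine ⟨((hρ.max aemeasurable_const).mul
      (hφ.1.contDiff_one.continuous_gradient.norm.pow 2).aemeasurable).aestronglyMeasurable, ?_⟩
    rw [hasFiniteIntegral_iff_ofReal (Eventually.of_forall h0), ← he]
    exact lt_top_iff_ne_top.2 hφ.2
  exact ⟨hi, by rw [he, ofReal_integral_eq_lintegral_ofReal hi (Eventually.of_forall h0)]⟩

theorem IsTestFun.lintegral_enorm_sq {U : Set (EuclideanSpace ℝ (Fin N))}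
    {φ : EuclideanSpace ℝ (Fin N) → ℝ} (hφ : IsTestFun U φ) :
    ∫⁻ x in U, ‖φ x‖ₑ ^ 2 = ENNReal.ofReal (∫ x in U, φ x ^ 2) := by
  rw [ofReal_integral_eq_lintegral_ofReal hφ.memLp.integrable_sq
    (Eventually.of_forall fun x => sq_nonneg _)]
  refine lintegral_congr fun x => ?_
  rw [← ofReal_norm, ← ENNReal.ofReal_pow (norm_nonneg _), Real.norm_eq_abs, sq_abs]

/-- The real form of `exists_lintegral_enorm_le_volume_rpow_mul`. -/
theorem exists_integral_norm_le_volume_rpow_mul (hN : 2 ≤ N) :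
    ∃ C : ℝ, 0 ≤ C ∧
      ∀ (U : Set (EuclideanSpace ℝ (Fin N))) (h : EuclideanSpace ℝ (Fin N) → ℝ),
      MeasurableSet U → volume U ≠ ⊤ → ContDiff ℝ 1 h → HasCompactSupport h → tsupport h ⊆ U →
      ∫ x in U, ‖h x‖ ≤ C * (volume U).toReal ^ (1 / (N : ℝ)) * ∫ x in U, ‖gradient h x‖ := by
  obtain ⟨C, hC⟩ := exists_lintegral_enorm_le_volume_rpow_mul hN
  refine ⟨C, C.2, fun U h hU hv hh hc hs => ?_⟩
  have i1 : Integrable h := hh.continuous.integrable_of_hasCompactSupport hc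
  have i2 : Integrable (gradient h) := by
    refine hh.continuous_gradient.integrable_of_hasCompactSupport ?_
    exact hc.of_isClosed_subset (isClosed_tsupport _) (closure_minimal (fun x hx => by
      by_contra hx'
      exact hx (gradient_eq_zero_of_notMem_tsupport hx')) (isClosed_tsupport _))
  have := hC U h hU hh hc hs
  rw [← ofReal_integral_norm_eq_lintegral_enorm i1.integrableOn,
    ← ofReal_integral_norm_eq_lintegral_enorm i2.integrableOn] at this
  have h2 := ENNReal.toReal_mono (ENNReal.mul_ne_top (ENNReal.mul_ne_top ENNReal.coe_ne_top
    (ENNReal.rpow_ne_top_of_nonneg (by positivity) hv)) ENNReal.ofReal_ne_top) this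
  rwa [ENNReal.toReal_ofReal (integral_nonneg fun _ => norm_nonneg _), ENNReal.toReal_mul,
    ENNReal.toReal_mul, ENNReal.toReal_ofReal (integral_nonneg fun _ => norm_nonneg _),
    ← ENNReal.toReal_rpow, ENNReal.coe_toReal] at h2

/-- On the region where a continuous function `q` is at least `m`, test functions on sets of small
measure are controlled by the energy, if the weight is bounded below where `q` is positive. -/
theorem exists_integral_sq_cutoff_le (hN : 2 ≤ N) {ρ : EuclideanSpace ℝ (Fin N) → ℝ}
    {K D : Set (EuclideanSpace ℝ (Fin N))} (hK : IsCompact K) (hDK : D ⊆ K)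
    {q : EuclideanSpace ℝ (Fin N) → ℝ} (hq : ContinuousOn q K)
    (hρ : ∀ U, IsOpen U → U ⊆ D → AEMeasurable ρ (volume.restrict U))
    (hρq : ∀ m : ℝ, 0 < m → ∃ c : ℝ, 0 < c ∧ ∀ x ∈ D, m ≤ q x → c ≤ ρ x) {m : ℝ} (hm : 0 < m) :
    ∃ (η : EuclideanSpace ℝ (Fin N) → ℝ) (C : ℝ), Continuous η ∧ (∀ x, η x ∈ Icc 0 1) ∧
      (∀ x ∈ K, m ≤ q x → η x = 1) ∧ 0 ≤ C ∧
      ∀ U, IsOpen U → U ⊆ D → ∀ φ, IsFiniteTestFun ρ U φ →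
        ∫ x in U, η x ^ 2 * φ x ^ 2 ≤ C * (volume U).toReal ^ (1 / (N : ℝ)) *
          ((∫ x in U, φ x ^ 2) + ∫ x in U, max (ρ x) 0 * ‖gradient φ x‖ ^ 2) := by
  obtain ⟨C, hC0, hC⟩ := exists_integral_norm_le_volume_rpow_mul hN
  obtain ⟨c, hc, hcρ⟩ := hρq (m / 2) (half_pos hm)
  have cl1 : IsClosed (K ∩ q ⁻¹' Iic (m / 2)) :=
    hq.preimage_isClosed_of_isClosed hK.isClosed isClosed_Iic
  have cl2 : IsClosed (K ∩ q ⁻¹' Ici m) :=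
    hq.preimage_isClosed_of_isClosed hK.isClosed isClosed_Ici
  -- A `C¹` cutoff, equal to 1 where `q ≥ m` and 0 where `q ≤ m / 2`. The Sobolev inequality is
  -- applied to `(η φ)²`, whose `L¹` norm is the integral to bound.
  obtain ⟨ζ, hζ0, hζ1, hζ⟩ := exists_contMDiffMap_zero_one_of_isClosed (n := 1)
    (modelWithCornersSelf ℝ (EuclideanSpace ℝ (Fin N))) cl1 cl2
    (disjoint_left.2 fun x h1 h2 => by
      have h1' : q x ≤ m / 2 := h1.2
      have h2' : m ≤ q x := h2.2
      linarith)
  have hηd : ContDiff ℝ 1 ζ := ζ.contMDiff.contDiff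
  generalize hη : (ζ : EuclideanSpace ℝ (Fin N) → ℝ) = η at *
  obtain ⟨H, hH⟩ := hK.exists_bound_of_continuousOn hηd.continuous_gradient.continuousOn
  set H' := max H 0
  refine ⟨η, C * (2 * H' + 1 + 1 / c), hηd.continuous, hζ, fun x hx hmx => hζ1 ⟨hx, hmx⟩,
    by positivity, fun U hU hUD φ hφ => ?_⟩
  have hfin : volume U ≠ ⊤ :=
    ((measure_mono (hUD.trans hDK)).trans_lt hK.measure_lt_top).ne
  obtain ⟨iE, -⟩ := hφ.integrableOn_and_energy_eq (hρ U hU hUD)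
  have iW := hφ.1.memLp.integrable_sq
  have hφd := hφ.1.contDiff_one
  have hhd : ContDiff ℝ 1 fun x => (η x * φ x) ^ 2 := (hηd.mul hφd).pow 2
  have hss : tsupport (fun x => (η x * φ x) ^ 2) ⊆ tsupport φ :=
    closure_mono fun x hx hφx => hx (by simp [hφx])
  have hcs : HasCompactSupport fun x => (η x * φ x) ^ 2 :=
    hφ.1.compact.of_isClosed_subset (isClosed_tsupport _) hss
  have key := hC U _ hU.measurableSet hfin hhd hcs (hss.trans hφ.1.subset)
  have hgrad : ∀ x, gradient (fun x => (η x * φ x) ^ 2) x =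
      (2 * (η x * φ x)) • (η x • gradient φ x + φ x • gradient η x) := fun x => by
    have h1 : HasFDerivAt (fun x => (η x * φ x) ^ 2) _ x :=
      ((hηd.differentiable one_ne_zero x).hasFDerivAt.mul
      (hφd.differentiable one_ne_zero x).hasFDerivAt).pow 2
    rw [gradient, h1.fderiv]
    simp [gradient]
  have hpt : ∀ x ∈ U, ‖gradient (fun x => (η x * φ x) ^ 2) x‖ ≤
      (2 * H' + 1) * φ x ^ 2 + 1 / c * (max (ρ x) 0 * ‖gradient φ x‖ ^ 2) := fun x hx => by
    have hxK := hDK (hUD hx)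
    have hb : ‖gradient η x‖ ≤ H' := (hH x hxK).trans (le_max_left _ _)
    obtain ⟨e0, e1⟩ := hζ x
    -- Where `η` is nonzero, `q > m / 2`, hence `ρ ≥ c`; elsewhere the left side is zero.
    have hw : η x ^ 2 * ‖gradient φ x‖ ^ 2 ≤ 1 / c * (max (ρ x) 0 * ‖gradient φ x‖ ^ 2) := by
      rcases e0.eq_or_lt with h | h
      · rw [← h]
        have : 0 ≤ 1 / c * (max (ρ x) 0 * ‖gradient φ x‖ ^ 2) := by positivity
        simpa using this
      · have hcx : c ≤ max (ρ x) 0 := (hcρ x (hUD hx) (by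
          by_contra! hlt
          exact h.ne' (hζ0 ⟨hxK, hlt.le⟩))).trans (le_max_left _ _)
        rw [← mul_assoc]
        refine mul_le_mul_of_nonneg_right ?_ (sq_nonneg _)
        calc η x ^ 2 ≤ 1 := by nlinarith
          _ ≤ 1 / c * max (ρ x) 0 := by rw [one_div_mul_eq_div, one_le_div hc]; exact hcx
    calc ‖gradient (fun x => (η x * φ x) ^ 2) x‖
        ≤ 2 * (η x * |φ x|) * (η x * ‖gradient φ x‖ + |φ x| * ‖gradient η x‖) := by
          rw [hgrad, norm_smul, norm_mul, norm_mul, Real.norm_eq_abs (η x),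
            abs_of_nonneg e0, Real.norm_two, Real.norm_eq_abs]
          gcongr
          refine (norm_add_le _ _).trans_eq ?_
          rw [norm_smul, norm_smul, Real.norm_eq_abs (η x), abs_of_nonneg e0, Real.norm_eq_abs]
      _ ≤ (2 * H' + 1) * φ x ^ 2 + η x ^ 2 * ‖gradient φ x‖ ^ 2 := by
          have h1 : 2 * (η x * |φ x|) * (η x * ‖gradient φ x‖) ≤
              φ x ^ 2 + η x ^ 2 * ‖gradient φ x‖ ^ 2 := by
            have t1 := two_mul_le_add_sq (η x * |φ x|) (η x * ‖gradient φ x‖)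
            have t2 : (η x * |φ x|) ^ 2 ≤ φ x ^ 2 := by
              rw [mul_pow, sq_abs]
              exact mul_le_of_le_one_left (sq_nonneg _) (by nlinarith)
            rw [mul_pow (η x) ‖gradient φ x‖] at t1
            linarith
          have h2 : 2 * (η x * |φ x|) * (|φ x| * ‖gradient η x‖) ≤ 2 * H' * φ x ^ 2 := by
            have t : η x * ‖gradient η x‖ ≤ 1 * H' := by gcongr
            have t' := mul_le_mul_of_nonneg_right t (sq_nonneg (φ x))
            rw [← sq_abs (φ x)] at t' ⊢
            nlinarith
          linarith
      _ ≤ _ := by linarith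
  calc ∫ x in U, η x ^ 2 * φ x ^ 2 = ∫ x in U, ‖(η x * φ x) ^ 2‖ := by
        refine integral_congr_ae (Eventually.of_forall fun x => ?_)
        simp only [Real.norm_eq_abs, abs_of_nonneg (sq_nonneg (η x * φ x))]
        rw [mul_pow]
    _ ≤ C * (volume U).toReal ^ (1 / (N : ℝ)) *
        ∫ x in U, ‖gradient (fun x => (η x * φ x) ^ 2) x‖ := key
    _ ≤ C * (volume U).toReal ^ (1 / (N : ℝ)) *
        ((2 * H' + 1) * (∫ x in U, φ x ^ 2) +
          1 / c * ∫ x in U, max (ρ x) 0 * ‖gradient φ x‖ ^ 2) := by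
        gcongr
        rw [← integral_const_mul, ← integral_const_mul,
          ← integral_add (iW.const_mul _) (iE.const_mul _)]
        refine integral_mono_of_nonneg (Eventually.of_forall fun x => norm_nonneg _)
          ((iW.const_mul _).add (iE.const_mul _)) ?_
        filter_upwards [ae_restrict_mem hU.measurableSet] with x hx using hpt x hx
    _ ≤ _ := by
        have hW : 0 ≤ ∫ x in U, φ x ^ 2 := integral_nonneg fun _ => sq_nonneg _
        have hE : 0 ≤ ∫ x in U, max (ρ x) 0 * ‖gradient φ x‖ ^ 2 :=
          integral_nonneg fun _ => by positivity
        have hv : 0 ≤ C * (volume U).toReal ^ (1 / (N : ℝ)) := by positivity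
        have hc' : 0 ≤ 1 / c := by positivity
        have hH' : 0 ≤ 2 * H' + 1 := by positivity
        calc _ ≤ C * (volume U).toReal ^ (1 / (N : ℝ)) * ((2 * H' + 1 + 1 / c) *
              ((∫ x in U, φ x ^ 2) + ∫ x in U, max (ρ x) 0 * ‖gradient φ x‖ ^ 2)) := by
              refine mul_le_mul_of_nonneg_left ?_ hv
              nlinarith [mul_nonneg hc' hW, mul_nonneg hH' hE]
          _ = _ := by ring

end Estimates

/-! ### Testing the equation and conclusion. -/

section Main

variable {N : ℕ} {A B f : ℝ → ℝ} {Ω : Set (EuclideanSpace ℝ (Fin N))}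
  {u : EuclideanSpace ℝ (Fin N) → ℝ}

theorem integrableOn_inner_of_isCompact {E V : Type*} [NormedAddCommGroup E] [MeasurableSpace E]
    [BorelSpace E] {μ : Measure E} [NormedAddCommGroup V] [InnerProductSpace ℝ V] {Ω S : Set E}
    (hS : IsCompact S) {F G : E → V}
    (hF : IntegrableOn F S μ) (hG : Continuous G) (hGS : ∀ x ∉ S, G x = 0) :
    IntegrableOn (fun x => inner ℝ (F x) (G x)) Ω μ := by
  obtain ⟨C, hC⟩ := hS.exists_bound_of_continuousOn hG.continuousOn
  have h : IntegrableOn (fun x => inner ℝ (F x) (G x)) S μ := by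
    refine (hF.norm.mul_const C).mono' (hF.aestronglyMeasurable.inner
      (hG.continuousOn.aestronglyMeasurable_of_isCompact hS hS.measurableSet)) ?_
    filter_upwards [ae_restrict_mem hS.measurableSet] with x hx
    exact (norm_inner_le_norm _ _).trans
      (mul_le_mul_of_nonneg_left (hC x hx) (norm_nonneg _))
  exact (h.of_forall_sdiff_eq_zero MeasurableSet.univ
    fun x hx => by rw [hGS x hx.2, inner_zero_right]).mono_set (subset_univ _)

/-- The flux has norm `A t * t` at `t = |∇u|`, which stays bounded on compact sets although `A`
alone need not. -/
theorem IsWeakSolution.integrableOn_flux (hA : IsCoeffA A) (hΩ : IsOpen Ω)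
    (hu : ContDiffOn ℝ 1 u Ω) {S : Set (EuclideanSpace ℝ (Fin N))} (hS : IsCompact S)
    (hSΩ : S ⊆ Ω) : IntegrableOn (fun x => A ‖gradient u x‖ • gradient u x) S := by
  have hc := (hu.continuousOn_gradient hΩ).mono hSΩ
  have hm : AEStronglyMeasurable (gradient u) (volume.restrict S) :=
    hc.aestronglyMeasurable_of_isCompact hS hS.measurableSet
  obtain ⟨T, hT⟩ := hS.exists_bound_of_continuousOn hc
  obtain ⟨C, -, hC⟩ := hA.exists_mul_le T
  refine (integrableOn_const (C := C) hS.measure_lt_top.ne).mono'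
    ((hA.aemeasurable_comp_norm hm).aestronglyMeasurable.smul hm) ?_
  filter_upwards [ae_restrict_mem hS.measurableSet] with x hx
  have h0 := hA.mul_nonneg (norm_nonneg (gradient u x))
  rw [norm_smul, Real.norm_eq_abs, ← abs_of_nonneg (norm_nonneg (gradient u x)), ← abs_mul,
    abs_norm, abs_of_nonneg h0]
  exact hC _ ⟨norm_nonneg _, hT x hx⟩

/-- The weak formulation holds for compactly supported `C¹` test functions. -/
theorem IsWeakSolution.setIntegral_eq_zero (hA : IsCoeffA A) (hB : IsCoeffB A B)
    (hf : Continuous f) (hΩ : IsOpen Ω) (hu : IsWeakSolution A B f Ω u)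
    {ψ : EuclideanSpace ℝ (Fin N) → ℝ} (hψ : ContDiff ℝ 1 ψ) (hc : HasCompactSupport ψ)
    (hs : tsupport ψ ⊆ Ω) :
    IntegrableOn (fun x => A ‖gradient u x‖ * inner ℝ (gradient u x) (gradient ψ x) +
      B ‖gradient u x‖ * ψ x - f (u x) * ψ x) Ω ∧
    ∫ x in Ω, (A ‖gradient u x‖ * inner ℝ (gradient u x) (gradient ψ x) +
      B ‖gradient u x‖ * ψ x - f (u x) * ψ x) = 0 := by
  have hu1 := hu.regular.1
  have hF : ∀ S, IsCompact S → S ⊆ Ω → IntegrableOn (fun x => A ‖gradient u x‖ • gradient u x) S :=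
    fun S hS hSΩ => integrableOn_flux hA hΩ hu1 hS hSΩ
  have hBi : ∀ S, IsCompact S → S ⊆ Ω → IntegrableOn (fun x => B ‖gradient u x‖) S :=
    fun S hS hSΩ => (hB.contDiffOn.continuousOn.comp ((hu1.continuousOn_gradient hΩ).mono hSΩ).norm
      fun x _ => norm_nonneg _).integrableOn_compact hS
  have hfi : ∀ S, IsCompact S → S ⊆ Ω → IntegrableOn (fun x => f (u x)) S :=
    fun S hS hSΩ => (hf.comp_continuousOn (hu1.continuousOn.mono hSΩ)).integrableOn_compact hS
  have key := weak_identity_of_contDiff_one hΩ hF hBi hfi (fun χ h1 h2 h3 => by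
    simpa only [real_inner_smul_left] using hu.weak χ ⟨h1, h2, h3⟩) hψ hc hs
  have hK := hc.isCompact
  have i1 := integrableOn_inner_of_isCompact (Ω := Ω) hK (hF _ hK hs)
    hψ.continuous_gradient fun x hx => gradient_eq_zero_of_notMem_tsupport hx
  have i2 := integrableOn_inner_of_isCompact (Ω := Ω) hK (hBi _ hK hs)
    hψ.continuous fun x hx => image_eq_zero_of_notMem_tsupport hx
  have i3 := integrableOn_inner_of_isCompact (Ω := Ω) hK (hfi _ hK hs)
    hψ.continuous fun x hx => image_eq_zero_of_notMem_tsupport hx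
  simp only [real_inner_smul_left] at i1 key
  simp only [RCLike.inner_apply, conj_trivial] at i2 i3
  simp only [mul_comm (ψ _)] at i2 i3
  refine ⟨(i1.add i2).sub i3, ?_⟩
  exact (integral_sub (i1.add i2) i3).trans
    (sub_eq_zero.2 ((integral_add i1 i2).trans key))

/-- Testing with `φ² exp(-l u)`: a compactly supported `C¹` function and its gradient. -/
theorem contDiff_sq_mul_exp_and_inner_gradient (hΩ : IsOpen Ω) (hu : ContDiffOn ℝ 1 u Ω) (l : ℝ)
    {φ : EuclideanSpace ℝ (Fin N) → ℝ} (hφ : IsTestFun Ω φ) :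
    ContDiff ℝ 1 (fun x => φ x ^ 2 * Real.exp (-l * u x)) ∧
      ∀ x ∈ Ω, inner ℝ (gradient u x) (gradient (fun x => φ x ^ 2 * Real.exp (-l * u x)) x) =
        2 * φ x * Real.exp (-l * u x) * inner ℝ (gradient u x) (gradient φ x) -
          l * φ x ^ 2 * Real.exp (-l * u x) * ‖gradient u x‖ ^ 2 := by
  constructor
  · rw [contDiff_iff_contDiffAt]
    intro x
    by_cases hx : x ∈ Ω
    · exact (hφ.contDiff_one.contDiffAt.pow 2).mul
        (contDiffAt_const.mul (hu.contDiffAt (hΩ.mem_nhds hx))).exp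
    -- Outside `Ω` nothing is known of `u`, but `φ` vanishes near such a point.
    · have h0 : φ =ᶠ[𝓝 x] 0 := notMem_tsupport_iff_eventuallyEq.1 fun h => hx (hφ.subset h)
      refine (contDiffAt_const (c := (0 : ℝ))).congr_of_eventuallyEq ?_
      filter_upwards [h0] with y hy
      simp [hy]
  · intro x hx
    have hux := ((hu.differentiableOn one_ne_zero).differentiableAt (hΩ.mem_nhds hx)).hasFDerivAt
    have h1 : HasFDerivAt (fun x => φ x ^ 2 * Real.exp (-l * u x)) _ x :=
      ((hφ.differentiable x).hasFDerivAt.pow 2).mul (hux.const_mul (-l)).exp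
    rw [real_inner_comm, inner_gradient_left, h1.fderiv, ← real_inner_self_eq_norm_sq,
      real_inner_comm (gradient φ x), inner_gradient_left, inner_gradient_left]
    simp only [add_apply, smul_apply, smul_eq_mul,
      nsmul_eq_mul]
    push_cast
    ring

/-- Testing the equation with `φ² exp(-l u)`, for `l` large, controls `∫ φ²` on sets where the
source is positive at the critical points. -/
theorem IsWeakSolution.exists_integral_sq_le (hA : IsCoeffA A) (hB : IsCoeffB A B)
    (hf : Continuous f) (hΩ : IsOpen Ω) (hu : IsWeakSolution A B f Ω u)
    {K D : Set (EuclideanSpace ℝ (Fin N))} (hK : IsCompact K) (hDΩ : D ⊆ Ω) (hDK : D ⊆ K)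
    {v : EuclideanSpace ℝ (Fin N) → ℝ} {G : EuclideanSpace ℝ (Fin N) → EuclideanSpace ℝ (Fin N)}
    (hv : ContinuousOn v K) (hG : ContinuousOn G K) (hvu : EqOn v u D)
    (hGu : EqOn G (gradient u) D) (hpos : ∀ x ∈ K, G x = 0 → 0 < f (v x)) :
    ∃ C : ℝ, 0 < C ∧ ∀ U, IsOpen U → U ⊆ D → ∀ φ,
      IsFiniteTestFun (fun x => A ‖gradient u x‖) U φ → ∀ s : ℝ, 0 < s →
        ∫ x in U, φ x ^ 2 ≤ C * (s * (∫ x in U, A ‖G x‖ * ‖G x‖ ^ 2 * φ x ^ 2) +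
          1 / s * ∫ x in U, max (A ‖gradient u x‖) 0 * ‖gradient φ x‖ ^ 2) := by
  have hu1 := hu.regular.1
  have hq : ContinuousOn (fun x => A ‖G x‖ * ‖G x‖ ^ 2) K :=
    hA.continuousOn_mul_sq.comp hG.norm fun x _ => norm_nonneg _
  have hq0 : ∀ x, 0 ≤ A ‖G x‖ * ‖G x‖ ^ 2 := fun x => by
    have := mul_nonneg (hA.mul_nonneg (norm_nonneg (G x))) (norm_nonneg (G x))
    nlinarith
  obtain ⟨l, c, hl, hc, hlc⟩ := hK.exists_pos_le_add_mul
    (p := fun x => f (v x) - B ‖G x‖) ((hf.comp_continuousOn hv).sub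
      (hB.contDiffOn.continuousOn.comp hG.norm fun x _ => norm_nonneg _)) hq
    (fun x _ => hq0 x) fun x hx h => by
      have hGx : G x = 0 := by
        by_contra hne
        have := norm_pos_iff.2 hne
        exact (mul_pos (hA.pos _ this) (pow_pos this 2)).ne' h
      simpa [hGx, hB.zero] using hpos x hx hGx
  obtain ⟨R, hR⟩ := hK.exists_bound_of_continuousOn hv
  obtain ⟨M, hM⟩ := hK.exists_bound_of_continuousOn hq
  have hc1 : 0 < c * Real.exp (-l * R) := mul_pos hc (Real.exp_pos _)
  -- From `|u| ≤ R` on `D`, `exp(-l u)` lies between `exp(-l R)` and `exp(l R)`: the lower bound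
  -- serves the coercive term, the upper one the Young remainder.
  refine ⟨Real.exp (l * R) / (c * Real.exp (-l * R)), div_pos (Real.exp_pos _) hc1,
    fun U hU hUD φ hφ s hs => ?_⟩
  have hUΩ := hUD.trans hDΩ
  have hgm : AEStronglyMeasurable (gradient u) (volume.restrict U) :=
    ((hu1.continuousOn_gradient hΩ).mono hUΩ).aestronglyMeasurable hU.measurableSet
  have iW := hφ.1.memLp.integrable_sq
  obtain ⟨iE, -⟩ := hφ.integrableOn_and_energy_eq (hA.aemeasurable_comp_norm hgm)
  have iY : IntegrableOn (fun x => A ‖G x‖ * ‖G x‖ ^ 2 * φ x ^ 2) U := by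
    refine (iW.const_mul M).mono' (((hq.mono (hUD.trans hDK)).aestronglyMeasurable
      hU.measurableSet).mul iW.aestronglyMeasurable) ?_
    filter_upwards [ae_restrict_mem hU.measurableSet] with x hx
    rw [norm_mul, Real.norm_of_nonneg (sq_nonneg (φ x))]
    exact mul_le_mul_of_nonneg_right (hM x (hDK (hUD hx))) (sq_nonneg _)
  have hφΩ : IsTestFun Ω φ := ⟨hφ.1.smooth, hφ.1.compact, hφ.1.subset.trans hUΩ⟩
  obtain ⟨hψ, hin⟩ := contDiff_sq_mul_exp_and_inner_gradient hΩ hu1 l hφΩ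
  set ψ := fun x => φ x ^ 2 * Real.exp (-l * u x) with hψdef
  have hss : tsupport ψ ⊆ tsupport φ :=
    closure_mono fun x hx hφx => hx (by simp [hψdef, hφx])
  obtain ⟨iI, hI⟩ := hu.setIntegral_eq_zero hA hB hf hΩ hψ
    (hφ.1.compact.of_isClosed_subset (isClosed_tsupport _) hss) (hss.trans hφΩ.subset)
  rw [setIntegral_eq_of_subset_of_forall_sdiff_eq_zero hΩ.measurableSet hUΩ fun x hx => by
    have hx' : x ∉ tsupport ψ := fun h => hx.2 (hφ.1.subset (hss h))
    simp [gradient_eq_zero_of_notMem_tsupport hx', image_eq_zero_of_notMem_tsupport hx']] at hI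
  have hpt : ∀ x ∈ U, A ‖gradient u x‖ * inner ℝ (gradient u x) (gradient ψ x) +
      B ‖gradient u x‖ * ψ x - f (u x) * ψ x ≤
      Real.exp (l * R) * (s * (A ‖G x‖ * ‖G x‖ ^ 2 * φ x ^ 2) +
        1 / s * (max (A ‖gradient u x‖) 0 * ‖gradient φ x‖ ^ 2)) -
        c * Real.exp (-l * R) * φ x ^ 2 := by
    intro x hx
    have hxD := hUD hx
    have hxK := hDK hxD
    have hV := hlc x hxK
    have hRx := abs_le.1 (hR x hxK)
    have hS0 : 0 ≤ s * (A ‖G x‖ * ‖G x‖ ^ 2 * φ x ^ 2) +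
        1 / s * (max (A ‖gradient u x‖) 0 * ‖gradient φ x‖ ^ 2) :=
      add_nonneg (mul_nonneg hs.le (mul_nonneg (hq0 x) (sq_nonneg _))) (by positivity)
    have hyoung : 2 * A ‖gradient u x‖ * φ x * inner ℝ (gradient u x) (gradient φ x) ≤
        s * (A ‖G x‖ * ‖G x‖ ^ 2 * φ x ^ 2) +
        1 / s * (max (A ‖gradient u x‖) 0 * ‖gradient φ x‖ ^ 2) := by
      -- Critical points are treated apart because `A 0` has no sign; there the left side is zero.
      by_cases h0 : gradient u x = 0
      · rw [h0, inner_zero_left, mul_zero, ← h0]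
        exact hS0
      · have hApos := hA.pos _ (norm_pos_iff.2 h0)
        rw [hGu hxD, max_eq_left hApos.le]
        have h1 : φ x * inner ℝ (gradient u x) (gradient φ x) ≤
            |φ x| * (‖gradient u x‖ * ‖gradient φ x‖) := by
          refine (le_abs_self _).trans ?_
          rw [abs_mul]
          exact mul_le_mul_of_nonneg_left (abs_real_inner_le_norm _ _) (abs_nonneg _)
        have h2 : 2 * (|φ x| * (‖gradient u x‖ * ‖gradient φ x‖)) ≤
            s * (‖gradient u x‖ ^ 2 * φ x ^ 2) + 1 / s * ‖gradient φ x‖ ^ 2 := by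
          -- Young's inequality with parameter `s`, by completing the square.
          have h3 : 0 ≤ 1 / s * (s * (|φ x| * ‖gradient u x‖) - ‖gradient φ x‖) ^ 2 := by
            positivity
          have h4 : 1 / s * (s * (|φ x| * ‖gradient u x‖) - ‖gradient φ x‖) ^ 2 =
              s * (‖gradient u x‖ ^ 2 * |φ x| ^ 2) + 1 / s * ‖gradient φ x‖ ^ 2 -
                2 * (|φ x| * (‖gradient u x‖ * ‖gradient φ x‖)) := by
            field_simp
            ring
          rw [sq_abs] at h4
          linarith
        have h5 := mul_le_mul_of_nonneg_left ((mul_le_mul_of_nonneg_left h1 zero_le_two).trans h2)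
          hApos.le
        calc _ = A ‖gradient u x‖ *
              (2 * (φ x * inner ℝ (gradient u x) (gradient φ x))) := by ring
          _ ≤ _ := h5
          _ = _ := by ring
    rw [hin x (hDΩ hxD), hψdef]
    rw [hvu hxD] at hV hRx
    have he1 : Real.exp (-l * R) ≤ Real.exp (-l * u x) := Real.exp_le_exp.2 (by nlinarith)
    have he2 : Real.exp (-l * u x) ≤ Real.exp (l * R) := Real.exp_le_exp.2 (by nlinarith)
    rw [hGu hxD] at hV hyoung hS0 ⊢
    have h6 := (mul_le_mul_of_nonneg_left hyoung (Real.exp_pos (-l * u x)).le).trans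
      (mul_le_mul_of_nonneg_right he2 hS0)
    have h7 : c * Real.exp (-l * R) * φ x ^ 2 ≤ (f (u x) - B ‖gradient u x‖ +
        l * (A ‖gradient u x‖ * ‖gradient u x‖ ^ 2)) * Real.exp (-l * u x) * φ x ^ 2 :=
      mul_le_mul_of_nonneg_right (mul_le_mul hV he1 (Real.exp_pos _).le (hc.le.trans hV))
        (sq_nonneg _)
    linarith
  have hint := setIntegral_mono_on (iI.mono_set hUΩ)
    ((((iY.const_mul s).add (iE.const_mul (1 / s))).const_mul (Real.exp (l * R))).sub
      (iW.const_mul (c * Real.exp (-l * R)))) hU.measurableSet hpt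
  rw [hI] at hint
  have hsplit := integral_sub
    (((iY.const_mul s).add (iE.const_mul (1 / s))).const_mul (Real.exp (l * R)))
    (iW.const_mul (c * Real.exp (-l * R)))
  have hsplit' := integral_add (iY.const_mul s) (iE.const_mul (1 / s))
  simp only [Pi.add_apply, integral_const_mul] at hsplit hsplit' hint
  rw [div_mul_eq_mul_div, le_div_iff₀ hc1]
  simp only [Pi.sub_apply] at hint
  rw [hsplit, hsplit'] at hint
  linarith

/-- The weighted Poincaré inequality on a subset of a compact set to which `u` and `∇u` extend
continuously, the source being positive at the critical points. -/
theorem IsWeakSolution.weightedPoincare (hN : 2 ≤ N) (hA : IsCoeffA A) (hB : IsCoeffB A B)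
    (hf : Continuous f) (hΩ : IsOpen Ω) (hu : IsWeakSolution A B f Ω u)
    {K D : Set (EuclideanSpace ℝ (Fin N))} (hK : IsCompact K) (hDΩ : D ⊆ Ω) (hDK : D ⊆ K)
    {v : EuclideanSpace ℝ (Fin N) → ℝ} {G : EuclideanSpace ℝ (Fin N) → EuclideanSpace ℝ (Fin N)}
    (hv : ContinuousOn v K) (hG : ContinuousOn G K) (hvu : EqOn v u D)
    (hGu : EqOn G (gradient u) D) (hpos : ∀ x ∈ K, G x = 0 → 0 < f (v x)) :
    WeightedPoincare (fun x => A ‖gradient u x‖) D := by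
  have hu1 := hu.regular.1
  have hgm : ∀ U, IsOpen U → U ⊆ D → AEStronglyMeasurable (gradient u) (volume.restrict U) :=
    fun U hU hUD =>
      ((hu1.continuousOn_gradient hΩ).mono (hUD.trans hDΩ)).aestronglyMeasurable hU.measurableSet
  have hρ : ∀ U, IsOpen U → U ⊆ D →
      AEMeasurable (fun x => A ‖gradient u x‖) (volume.restrict U) :=
    fun U hU hUD => hA.aemeasurable_comp_norm (hgm U hU hUD)
  have hq : ContinuousOn (fun x => A ‖G x‖ * ‖G x‖ ^ 2) K :=
    hA.continuousOn_mul_sq.comp hG.norm fun x _ => norm_nonneg _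
  have hρq : ∀ m : ℝ, 0 < m → ∃ c : ℝ, 0 < c ∧ ∀ x ∈ D, m ≤ A ‖G x‖ * ‖G x‖ ^ 2 →
      c ≤ A ‖gradient u x‖ := by
    intro m hm
    -- On this compact set `G` has no zero, so the continuous function `A ‖G‖` has a positive
    -- minimum.
    have hKm : IsCompact (K ∩ (fun x => A ‖G x‖ * ‖G x‖ ^ 2) ⁻¹' Ici m) :=
      hK.of_isClosed_subset (hq.preimage_isClosed_of_isClosed hK.isClosed isClosed_Ici)
        inter_subset_left
    have hGpos : ∀ x ∈ K ∩ (fun x => A ‖G x‖ * ‖G x‖ ^ 2) ⁻¹' Ici m, 0 < ‖G x‖ := by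
      intro x hx
      refine (norm_nonneg _).lt_of_ne fun h => ?_
      have : m ≤ A ‖G x‖ * ‖G x‖ ^ 2 := hx.2
      rw [← h] at this
      norm_num at this
      linarith
    obtain ⟨c, hc, h⟩ := hKm.exists_forall_le'
      (hA.continuousOn_Ioi.comp (hG.mono inter_subset_left).norm hGpos) (a := 0)
      fun x hx => hA.pos _ (hGpos x hx)
    exact ⟨c, hc, fun x hx hmx => by rw [← hGu hx]; exact h x ⟨hDK hx, hmx⟩⟩
  obtain ⟨M', hM'⟩ := hK.exists_bound_of_continuousOn hq
  set M := max M' 0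
  have hM0 : 0 ≤ M := le_max_right _ _
  have hM : ∀ x ∈ K, A ‖G x‖ * ‖G x‖ ^ 2 ≤ M := fun x hx =>
    (le_abs_self _).trans ((hM' x hx).trans (le_max_left _ _))
  obtain ⟨C, hC, hCW⟩ := hu.exists_integral_sq_le hA hB hf hΩ hK hDΩ hDK hv hG hvu hGu hpos
  have hconv : ∀ U, IsOpen U → U ⊆ D → ∀ φ, IsFiniteTestFun (fun x => A ‖gradient u x‖) U φ →
      ∀ r : ℝ≥0, (∫ x in U, φ x ^ 2 ≤
        r * ∫ x in U, max (A ‖gradient u x‖) 0 * ‖gradient φ x‖ ^ 2) →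
      ∫⁻ x in U, ‖φ x‖ₑ ^ 2 ≤ r * energy (fun x => A ‖gradient u x‖) U (gradient φ) := by
    intro U hU hUD φ hφ r h
    rw [hφ.1.lintegral_enorm_sq, (hφ.integrableOn_and_energy_eq (hρ U hU hUD)).2,
      ← ENNReal.ofReal_coe_nnreal, ← ENNReal.ofReal_mul r.coe_nonneg]
    exact ENNReal.ofReal_le_ofReal h
  have hWn : ∀ (U : Set (EuclideanSpace ℝ (Fin N))) (φ : EuclideanSpace ℝ (Fin N) → ℝ),
      0 ≤ ∫ x in U, φ x ^ 2 := fun U φ => integral_nonneg fun _ => sq_nonneg _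
  have hEn : ∀ (U : Set (EuclideanSpace ℝ (Fin N))) (φ : EuclideanSpace ℝ (Fin N) → ℝ),
      0 ≤ ∫ x in U, max (A ‖gradient u x‖) 0 * ‖gradient φ x‖ ^ 2 :=
    fun U φ => integral_nonneg fun _ => by positivity
  have hYle : ∀ U, IsOpen U → U ⊆ D → ∀ φ, IsTestFun U φ →
      ∀ (m : ℝ) (η : EuclideanSpace ℝ (Fin N) → ℝ), 0 ≤ m → Continuous η →
        (∀ x, η x ∈ Icc 0 1) → (∀ x ∈ K, m ≤ A ‖G x‖ * ‖G x‖ ^ 2 → η x = 1) →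
      ∫ x in U, A ‖G x‖ * ‖G x‖ ^ 2 * φ x ^ 2 ≤
        m * (∫ x in U, φ x ^ 2) + M * ∫ x in U, η x ^ 2 * φ x ^ 2 := by
    intro U hU hUD φ hφ m η hm hη h01 h1
    have iW := hφ.memLp.integrable_sq
    have iX : IntegrableOn (fun x => η x ^ 2 * φ x ^ 2) U := by
      refine iW.mono' ((hη.pow 2).aestronglyMeasurable.mul iW.aestronglyMeasurable)
        (Eventually.of_forall fun x => ?_)
      rw [Real.norm_of_nonneg (by positivity)]
      exact mul_le_of_le_one_left (sq_nonneg _) (by nlinarith [(h01 x).1, (h01 x).2])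
    rw [← integral_const_mul, ← integral_const_mul, ← integral_add (iW.const_mul m)
      (iX.const_mul M)]
    refine integral_mono_of_nonneg (Eventually.of_forall fun x => ?_)
      ((iW.const_mul m).add (iX.const_mul M)) ?_
    · have := mul_nonneg (mul_nonneg (hA.mul_nonneg (norm_nonneg (G x))) (norm_nonneg (G x)))
        (sq_nonneg (φ x))
      change 0 ≤ A ‖G x‖ * ‖G x‖ ^ 2 * φ x ^ 2
      rwa [pow_two ‖G x‖, ← mul_assoc]
    · filter_upwards [ae_restrict_mem hU.measurableSet] with x hx
      have hxK := hDK (hUD hx)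
      rcases le_or_gt m (A ‖G x‖ * ‖G x‖ ^ 2) with h | h
      · rw [h1 x hxK h, one_pow, one_mul, ← add_mul]
        exact mul_le_mul_of_nonneg_right ((hM x hxK).trans (by linarith)) (sq_nonneg _)
      · have := mul_le_mul_of_nonneg_right h.le (sq_nonneg (φ x))
        have h2 : 0 ≤ M * (η x ^ 2 * φ x ^ 2) := by positivity
        linarith
  obtain ⟨C₀, hC₀⟩ : ∃ C₀ : ℝ≥0, ∀ U, IsOpen U → U ⊆ D → ∀ φ,
      IsFiniteTestFun (fun x => A ‖gradient u x‖) U φ → ∫ x in U, φ x ^ 2 ≤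
        C₀ * ∫ x in U, max (A ‖gradient u x‖) 0 * ‖gradient φ x‖ ^ 2 := by
    -- With this `s`, `Y ≤ M W` gives `C s Y ≤ W / 2`, which is absorbed on the left.
    have hs : 0 < 1 / (2 * C * (M + 1)) := by positivity
    refine ⟨(2 * C * (2 * C * (M + 1))).toNNReal, fun U hU hUD φ hφ => ?_⟩
    have h1 := hCW U hU hUD φ hφ _ hs
    have h2 := hYle U hU hUD φ hφ.1 0 (fun _ => 1) le_rfl continuous_const (by simp) (by simp)
    simp only [one_pow, one_mul, zero_mul, zero_add] at h2
    have hE := hEn U φ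
    have hW := hWn U φ
    rw [Real.coe_toNNReal _ (by positivity)]
    set W := ∫ x in U, φ x ^ 2
    set E := ∫ x in U, max (A ‖gradient u x‖) 0 * ‖gradient φ x‖ ^ 2
    set Y := ∫ x in U, A ‖G x‖ * ‖G x‖ ^ 2 * φ x ^ 2
    have h3 : C * (1 / (2 * C * (M + 1)) * Y) ≤ W / 2 := by
      calc C * (1 / (2 * C * (M + 1)) * Y) ≤ C * (1 / (2 * C * (M + 1)) * ((M + 1) * W)) := by
            gcongr
            linarith
        _ = W / 2 := by field_simp
    rw [one_div_one_div] at h1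
    linarith
  refine weightedPoincare_of_isFiniteTestFun hρ
    ⟨C₀, fun U hU hUD φ hφ => hconv U hU hUD φ hφ _ (hC₀ U hU hUD φ hφ)⟩ fun ε hε => ?_
  have hε' : (0 : ℝ) < ε := hε
  -- Now `C / s = ε / 4`, and the threshold `m = 1 / (2 C s)` makes the contribution of `q < m` at
  -- most `W / 2`.
  have hs : 0 < 4 * C / ε := by positivity
  set s : ℝ := 4 * C / ε with hsdef
  have hm : 0 < 1 / (2 * C * s) := by positivity
  obtain ⟨η, C', hη, h01, h1, hC', hX⟩ := exists_integral_sq_cutoff_le hN hK hDK hq hρ hρq hm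
  set L : ℝ := C * s * M * C' * (C₀ + 1)
  have hL : 0 ≤ L := by positivity
  have hN0 : (N : ℝ) ≠ 0 := by positivity
  have hδ0 : 0 < ε / (4 * (L + 1)) := by positivity
  have hδ1 : 0 < (ε / (4 * (L + 1))) ^ (N : ℝ) := Real.rpow_pos_of_pos hδ0 _
  -- Chosen so that `L |U|^{1/N} ≤ ε / 4`. Altogether `W ≤ W / 2 + ε E / 4 + ε E / 4`, that is, `W ≤
  -- ε E`.
  refine ⟨((ε / (4 * (L + 1))) ^ (N : ℝ)).toNNReal, Real.toNNReal_pos.2 hδ1,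
    fun U hU hUD hvol φ hφ => ?_⟩
  refine hconv U hU hUD φ hφ _ ?_
  have e1 := hCW U hU hUD φ hφ s hs
  have e2 := hYle U hU hUD φ hφ.1 _ η hm.le hη h01 h1
  have e3 := hX U hU hUD φ hφ
  have e4 := hC₀ U hU hUD φ hφ
  have e5 : (volume U).toReal ^ (1 / (N : ℝ)) ≤ ε / (4 * (L + 1)) := by
    have h := ENNReal.toReal_mono ENNReal.coe_ne_top hvol
    have h' := Real.rpow_le_rpow ENNReal.toReal_nonneg h (z := 1 / (N : ℝ)) (by positivity)
    refine h'.trans_eq ?_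
    rw [ENNReal.coe_toReal, Real.coe_toNNReal _ hδ1.le, ← Real.rpow_mul hδ0.le, mul_one_div_cancel hN0, Real.rpow_one]
  have hE := hEn U φ
  have hW := hWn U φ
  set W := ∫ x in U, φ x ^ 2
  set E := ∫ x in U, max (A ‖gradient u x‖) 0 * ‖gradient φ x‖ ^ 2
  set Y := ∫ x in U, A ‖G x‖ * ‖G x‖ ^ 2 * φ x ^ 2
  set X := ∫ x in U, η x ^ 2 * φ x ^ 2
  set t := (volume U).toReal ^ (1 / (N : ℝ))
  have ht : 0 ≤ t := by positivity
  have f1 : C * (1 / s * E) = ε / 4 * E := by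
    rw [hsdef]; field_simp
  have f2 : C * (s * (1 / (2 * C * s) * W)) = W / 2 := by
    field_simp
  have f3 : C * s * M * X ≤ ε / 4 * E := by
    calc C * s * M * X ≤ C * s * M * (C' * t * ((C₀ + 1) * E)) := by
          refine mul_le_mul_of_nonneg_left (e3.trans ?_) (by positivity)
          exact mul_le_mul_of_nonneg_left (by linarith) (by positivity)
      _ = L * t * E := by ring
      _ ≤ ε / 4 * E := by
          refine mul_le_mul_of_nonneg_right ?_ hE
          calc L * t ≤ (L + 1) * (ε / (4 * (L + 1))) := by gcongr; linarith
            _ = ε / 4 := by field_simp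
  have f4 := mul_le_mul_of_nonneg_left e2 (show 0 ≤ C * s by positivity)
  linarith

end Main

/-- For compact `D` the extensions are `u` and `∇u` themselves. For `D = Ω` the compact set is the
closure: `u`, and with it the source, may vanish on the boundary, but positivity is only needed at
zeros of `G`, and these lie in `Ω`. -/
theorem theorem1p3 (N : ℕ) (hN : 2 ≤ N) (A B f : ℝ → ℝ)
    (hA : IsCoeffA A) (hB : IsCoeffB A B)
    (hf : LocallyLipschitz f) (hfpos : ∀ s : ℝ, 0 < s → 0 < f s)
    (Ω : Set (EuclideanSpace ℝ (Fin N))) (hΩ : IsOpen Ω)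
    (u : EuclideanSpace ℝ (Fin N) → ℝ) (hu : IsWeakSolution A B f Ω u)
    (hupos : ∀ x ∈ Ω, 0 < u x) :
    (∀ K : Set (EuclideanSpace ℝ (Fin N)), IsCompact K → K ⊆ Ω →
      WeightedPoincare (fun x => A ‖gradient u x‖) K) ∧
    (Bornology.IsBounded Ω → NoBoundaryCritical Ω u →
      WeightedPoincare (fun x => A ‖gradient u x‖) Ω) := by
  have hu1 := hu.regular.1
  refine ⟨fun K hK hKΩ => ?_, fun hbd ⟨v, G, hv, hvu, hG, hGu, hG0⟩ => ?_⟩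
  · exact hu.weightedPoincare hN hA hB hf.continuous hΩ hK hKΩ subset_rfl
      (hu1.continuousOn.mono hKΩ) ((hu1.continuousOn_gradient hΩ).mono hKΩ)
      (fun _ _ => rfl) (fun _ _ => rfl) fun x hx _ => hfpos _ (hupos x (hKΩ hx))
  · refine hu.weightedPoincare hN hA hB hf.continuous hΩ hbd.isCompact_closure subset_rfl
      subset_closure hv hG hvu hGu fun x hx hGx => ?_
    have hxΩ : x ∈ Ω := by
      by_contra h
      exact hG0 x ⟨hx, fun h' => h (interior_subset h')⟩ hGx
    rw [hvu hxΩ]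
    exact hfpos _ (hupos x hxΩ)
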